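/- Setting. Let $X\subseteq\mathbb R^d$ with $\overline X=\overline{\operatorname{int}X}$, let $\mathcal H$ be a real reproducing kernel Hilbert space of functions on $X$ whose kernel $k$ is of class $C^2$ on $X\times X$ (continuous on $X\times X$, $C^2$ in the interior, with derivatives of order one and two that extend continuously to $X\times X$), and let $k_x=k(x,\cdot)$ and $(\partial_a k)_x=\frac{\partial k(s,\cdot)}{\partial s^a}\big|_{s=x}\in\mathcal H$. Let $x_1,\dots,x_n\in X$ and $y\in\mathbb R^n$, $n\ge1$. On $\mathbb R^n$ use $\langle u,v\rangle_n=\frac1n\sum_iu_iv_i$ with norm $\|\cdot\|_n$, and on $(\mathbb R^n)^d$ the inner product $\sum_a\langle u_a,v_a\rangle_n$. For $f\in\mathcal H$ put $$(Sf)_i=\langle f,k_{x_i}\rangle,\quad (\hat D_af)_i=\langle f,(\partial_ak)_{x_i}\rangle=\tfrac{\partial f}{\partial x^a}(x_i),\quad \hat\nabla f=(\hat D_af)_{a=1}^d,$$ $$\hat{\mathcal E}(f)=\tfrac1n\sum_i(y_i-f(x_i))^2,\quad \hat\Omega(f)=\sum_{a=1}^d\Big\|\tfrac{\partial f}{\partial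 x^a}\Big\|_n=\sum_{a=1}^d\Big(\tfrac1n\sum_i\big(\tfrac{\partial f}{\partial x^a}(x_i)\big)^2\Big)^{1/2},$$ $$\hat{\mathcal E}^\tau(f)=\hat{\mathcal E}(f)+\tau\big(2\hat\Omega(f)+\nu\|f\|^2\big).$$ Let $\tau,\nu>0$ and let $\hat f^\tau$ be the minimizer of $\hat{\mathcal E}^\tau$ on $\mathcal H$. (1) Let $\sigma>0$ and let $v=(v_a)_{a=1}^d\in(\mathbb R^n)^d$ with $\|v_a\|_n\le\tau/\sigma$ for all $a$ satisfy $\hat\nabla^*v=-\frac1{2\sigma}\nabla\big(\hat{\mathcal E}+\tau\nu\|\cdot\|^2\big)(\hat f^\tau)$. Then, for every $a$, $\|v_a\|_n<\frac\tau\sigma$ implies $\|\hat D_a\hat f^\tau\|_n=0$. (2) Let $\sigma\ge\|S^*S\|+\tau\nu$, $\eta>0$ with $\eta\ge\|\hat\nabla\hat\nabla^*\|$, and let the tolerances satisfy $\varepsilon^t\asymp t^{-l}$ as $t\to\infty$, with $l>3/2$. Let $K,Z_a,L_{a,b}$ be the $n\times n$ matrices of $SS^*$, $S\hat D_a^*$,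 $\hat D_a\hat D_b^*$, that is, $$K_{ij}=\tfrac1nk(x_i,x_j),\quad (Z_a)_{ij}=\tfrac1n\tfrac{\partial k(s,x_i)}{\partial s^a}\Big|_{s=x_j},\quad (L_{a,b})_{ij}=\tfrac1n\tfrac{\partial^2k(u,s)}{\partial u^a\partial s^b}\Big|_{u=x_i,s=x_j}.$$ Consider sequences $\alpha^t\in\mathbb R^n$ and $\beta^t,\bar v^t\in(\mathbb R^n)^d$ generated as follows: $\alpha^0=\alpha^1=0$, $\beta^0=\beta^1=0$, $\bar v^1=0$, $s_1=1$ and, for $t\ge2$, $$s_t=\tfrac12\Big(1+\sqrt{1+4s_{t-1}^2}\Big),\quad (\tilde\alpha^t,\tilde\beta^t)=\Big(1+\tfrac{s_{t-1}-1}{s_t}\Big)(\alpha^{t-1},\beta^{t-1})+\tfrac{1-s_{t-1}}{s_t}(\alpha^{t-2},\beta^{t-2}),$$ $$\alpha^t=\big(1-\tfrac{\tau\nu}\sigma\big)\tilde\alpha^t-\tfrac1\sigma\Big(K\tilde\alpha^t+\sum_aZ_a\tilde\beta^t_a-y\Big),\quad \beta^t=\big(1-\tfrac{\tau\nu}\sigma\big)\tilde\beta^t-\bar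 v^t,$$ where $\bar v^t$ is the result of finitely many steps, started at $\bar v^{t-1}$, of the iteration $$v_a\leftarrow\pi\Big(v_a-\tfrac1\eta\Big(\sum_bL_{a,b}v_b-Z_a^T\alpha^t-\big(1-\tfrac{\tau\nu}\sigma\big)\sum_bL_{a,b}\tilde\beta_b^t\Big)\Big),\quad a=1,\dots,d,$$ $\pi$ being the projection onto the ball of radius $\tau/\sigma$ for $\|\cdot\|_n$. Let $f^t=\frac1n\sum_i\alpha^t_ik_{x_i}+\frac1n\sum_i\sum_a\beta^t_{a,i}(\partial_ak)_{x_i}$, and suppose that for every $t\ge2$ the number of inner steps is such that $$\tfrac{2\tau}\sigma\hat\Omega(f^t)-2\langle\hat\nabla^*\bar v^t,f^t\rangle\le(\varepsilon^t)^2.$$ Then there is a constant $C>0$ with $\hat{\mathcal E}^\tau(f^t)-\hat{\mathcal E}^\tau(\hat f^\tau)\le C/t^2$ for all $t\ge2$ such that the numbers $\tilde\varepsilon^t\ge0$ defined by $$(\tilde\varepsilon^t)^2=(\varepsilon^t)^2+\sqrt{\tfrac C{\tau\nu}}\Big(\tfrac\tau\sigma\sum_{a=1}^d\sqrt{\|\hat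 D_a^*\hat D_a\|}+1\Big)\frac4t$$ are positive for $t\ge2$, satisfy $\lim_{t\to\infty}\tilde\varepsilon^t=0$, and, if $m$ is the least positive number among the $\|\hat D_a\hat f^\tau\|_n$, $a=1,\dots,d$ (when there is one), then for all $t\ge2$ and all $a$ $$\|\bar v^t_a\|_n<\frac\tau\sigma-\frac{(\tilde\varepsilon^t)^2}{2m}\ \Longrightarrow\ \|\hat D_a\hat f^\tau\|_n=0.$$ -/

import Mathlib

open Filter Topology

noncomputable section

/-! ### The space `ℝⁿ` with inner product normalized by `1/n` -/

/-- `ℝⁿ` with the normalized inner product `⟨u, v⟩ₙ = (1/n) ∑ᵢ uᵢ vᵢ`. -/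
@[ext]
structure EmpVec (n : ℕ) : Type where
  /-- The vector with the given coordinates. -/
  mk ::
  /-- The coordinates of a vector. -/
  coord : Fin n → ℝ

namespace EmpVec

variable {n : ℕ}

instance : CoeFun (EmpVec n) (fun _ => Fin n → ℝ) := ⟨coord⟩

/-- The bijection with `Fin n → ℝ`. -/
def equivFun (n : ℕ) : EmpVec n ≃ (Fin n → ℝ) := ⟨coord, mk, fun _ => rfl, fun _ => rfl⟩

instance : AddCommGroup (EmpVec n) := (equivFun n).addCommGroup

instance : Module ℝ (EmpVec n) := (equivFun n).module ℝ

instance : FiniteDimensional ℝ (EmpVec n) :=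
  Module.Finite.equiv ((equivFun n).linearEquiv ℝ).symm

@[simp] theorem zero_apply (i : Fin n) : (0 : EmpVec n) i = 0 := rfl

@[simp] theorem add_apply (u v : EmpVec n) (i : Fin n) : (u + v) i = u i + v i := rfl

@[simp] theorem neg_apply (u : EmpVec n) (i : Fin n) : (-u) i = -u i := rfl

@[simp] theorem sub_apply (u v : EmpVec n) (i : Fin n) : (u - v) i = u i - v i := rfl

@[simp] theorem smul_apply (c : ℝ) (u : EmpVec n) (i : Fin n) : (c • u) i = c * u i := rfl

/-- The inner product `⟨u, v⟩ₙ = (1/n) ∑ᵢ uᵢ vᵢ`. -/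
@[reducible]
def core (n : ℕ) [NeZero n] : InnerProductSpace.Core ℝ (EmpVec n) where
  inner u v := (1 / (n : ℝ)) * ∑ i, u i * v i
  conj_inner_symm u v := by simp [mul_comm]
  re_inner_nonneg u := by
    simp only [RCLike.re_to_real]
    exact mul_nonneg (by positivity) (Finset.sum_nonneg fun i _ => mul_self_nonneg _)
  add_left u v w := by simp [add_mul, Finset.sum_add_distrib, mul_add]
  smul_left u v r := by
    simp only [smul_apply, conj_trivial, mul_assoc, ← Finset.mul_sum]
    ring
  definite u h := by
    have hn : (n : ℝ) ≠ 0 := Nat.cast_ne_zero.mpr (NeZero.ne n)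
    have h0 : ∑ i, u i * u i = 0 := by
      rcases mul_eq_zero.mp h with h | h
      · exact absurd h (one_div_ne_zero hn)
      · exact h
    rw [Finset.sum_eq_zero_iff_of_nonneg fun i _ => mul_self_nonneg _] at h0
    ext i
    exact mul_self_eq_zero.mp (h0 i (Finset.mem_univ i))

instance [NeZero n] : NormedAddCommGroup (EmpVec n) := (core n).toNormedAddCommGroup

instance [NeZero n] : InnerProductSpace ℝ (EmpVec n) := .ofCore (core n).toCore

instance [NeZero n] : CompleteSpace (EmpVec n) := FiniteDimensional.complete ℝ _

theorem inner_def [NeZero n] (u v : EmpVec n) :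
    inner ℝ u v = (1 / (n : ℝ)) * ∑ i, u i * v i := rfl

theorem norm_def [NeZero n] (u : EmpVec n) :
    ‖u‖ = Real.sqrt ((1 / (n : ℝ)) * ∑ i, u i ^ 2) := by
  rw [norm_eq_sqrt_real_inner (F := EmpVec n), inner_def]
  simp only [sq]

/-- The identification of `Fin n → ℝ` with `EmpVec n`. -/
def ofFun (n : ℕ) [NeZero n] : (Fin n → ℝ) →L[ℝ] EmpVec n :=
  LinearMap.toContinuousLinearMap ((equivFun n).linearEquiv ℝ).symm.toLinearMap

@[simp] theorem ofFun_apply [NeZero n] (u : Fin n → ℝ) (i : Fin n) : ofFun n u i = u i := rfl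

end EmpVec

/-- `(ℝⁿ)ᵈ` with the Hilbert direct sum norm `‖v‖² = ∑ₐ ‖vₐ‖ₙ²`. -/
abbrev GradVec (d n : ℕ) : Type := PiLp 2 (fun _ : Fin d => EmpVec n)

/-- The product of `d` balls of radius `r` in `ℝⁿ`, that is `r • Bₙᵈ`. -/
def prodBall (d n : ℕ) [NeZero n] (r : ℝ) : Set (GradVec d n) := {v | ∀ a, ‖v a‖ ≤ r}

/-! ### Partial derivatives of functions on `X ⊆ ℝᵈ` -/

/-- Extension by zero of a function on `X`. -/
def zeroExt {E F : Type*} [Zero F] (X : Set E) (f : X → F) : E → F :=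
  Function.extend (Subtype.val : X → E) f 0

theorem zeroExt_apply {E F : Type*} [Zero F] {X : Set E} (f : X → F) (x : X) :
    zeroExt X f x = f x :=
  Subtype.val_injective.extend_apply f 0 x

/-- The partial derivative `∂f/∂xᵃ` at a point `x ∈ X`: the usual one if `x` is an interior point
of `X`, and otherwise the limit of the partial derivatives at interior points tending to `x`. -/
def partialDeriv {d : ℕ} {X : Set (EuclideanSpace ℝ (Fin d))} (a : Fin d) (f : X → ℝ) (x : X) :
    ℝ :=
  open Classical in
  if (x : EuclideanSpace ℝ (Fin d)) ∈ interior X then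
    lineDeriv ℝ (zeroExt X f) x (EuclideanSpace.single a 1)
  else
    limUnder (𝓝[interior X] (x : EuclideanSpace ℝ (Fin d)))
      (fun z => lineDeriv ℝ (zeroExt X f) z (EuclideanSpace.single a 1))

/-- `g` is of class `C²` on `S`: continuous on `S`, `C²` in the interior of `S`, and the
derivatives of order one and two extend continuously from the interior to `S`. -/
def IsC2On {F : Type*} [NormedAddCommGroup F] [NormedSpace ℝ F] (S : Set F) (g : F → ℝ) : Prop :=
  ContinuousOn g S ∧ ContDiffOn ℝ 2 g (interior S) ∧
  (∃ G : F → F →L[ℝ] ℝ, ContinuousOn G S ∧ Set.EqOn G (fderiv ℝ g) (interior S)) ∧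
  (∃ G : F → F →L[ℝ] F →L[ℝ] ℝ,
    ContinuousOn G S ∧ Set.EqOn G (fderiv ℝ (fderiv ℝ g)) (interior S))

/-! ### The reproducing kernel Hilbert space -/

section Kernel

variable {d : ℕ} {X : Set (EuclideanSpace ℝ (Fin d))}
variable (H : Type*) [NormedAddCommGroup H] [InnerProductSpace ℝ H] [CompleteSpace H]
variable [RKHS ℝ H X ℝ]

/-- The function `k_x = k(x, ·)`, as an element of `H`. -/
def kerVec (x : X) : H := RKHS.kerFun H x 1

/-- The scalar reproducing kernel `k(s, t)` of `H`. -/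
def kerVal (s t : X) : ℝ := RKHS.kernel H s t 1

/-- The kernel as a function on `ℝᵈ × ℝᵈ` (zero outside of `X × X`). -/
def kerExt (p : EuclideanSpace ℝ (Fin d) × EuclideanSpace ℝ (Fin d)) : ℝ :=
  zeroExt X (fun s => zeroExt X (fun t => kerVal H s t) p.2) p.1

/-- The kernel is of class `C²` on `X × X`. -/
def KernelC2 : Prop := IsC2On (X ×ˢ X) (kerExt (X := X) H)

/-- `(∂ₐk)_x`: the element of `H` that is the function `t ↦ ∂k(s, t)/∂sᵃ` at `s = x`. -/
def kerDeriv (a : Fin d) (x : X) : H :=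
  Classical.epsilon fun g : H => ∀ t : X, g t = partialDeriv a (fun s => kerVal H s t) x

end Kernel

/-! ### Derivatives in the reproducing kernel Hilbert space -/

section Derivatives

variable {d : ℕ} {X : Set (EuclideanSpace ℝ (Fin d))}
variable {H : Type*} [NormedAddCommGroup H] [InnerProductSpace ℝ H] [CompleteSpace H]
variable [RKHS ℝ H X ℝ]

theorem inner_kerVec (x : X) (f : H) : inner ℝ (kerVec H x) f = f x := by
  simp [kerVec]

theorem kerVal_eq (s t : X) : kerVal H s t = inner ℝ (kerVec H s) (kerVec H t) := by
  rw [inner_kerVec, kerVec, RKHS.kerFun_apply]; rfl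

theorem kerVal_eq' (s t : X) : kerVal H s t = kerVec H t s := by
  rw [kerVal_eq, inner_kerVec]

theorem zeroExt_eq_inner (f : H) (z : EuclideanSpace ℝ (Fin d)) :
    zeroExt X (f : X → ℝ) z = inner ℝ (zeroExt X (kerVec H) z) f := by
  by_cases hz : z ∈ X
  · have h1 := zeroExt_apply (f : X → ℝ) ⟨z, hz⟩
    have h2 := zeroExt_apply (kerVec H) (⟨z, hz⟩ : X)
    simp only at h1 h2
    rw [h1, h2, inner_kerVec]
  · have hn : ¬ ∃ a : X, (a : EuclideanSpace ℝ (Fin d)) = z := by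
      rintro ⟨a, rfl⟩; exact hz a.2
    simp [zeroExt, Function.extend_apply' _ _ _ hn]

theorem kerExt_eq_inner (p : EuclideanSpace ℝ (Fin d) × EuclideanSpace ℝ (Fin d)) :
    kerExt (X := X) H p =
      inner ℝ (zeroExt X (kerVec H) p.1) (zeroExt X (kerVec H) p.2) := by
  have h : (fun s : X => zeroExt X (fun t => kerVal H s t) p.2) =
      ((zeroExt X (kerVec H) p.2 : H) : X → ℝ) := by
    funext s
    have : (fun t : X => kerVal H s t) = ((kerVec H s : H) : X → ℝ) := by
      funext t; rw [kerVal_eq, real_inner_comm, inner_kerVec]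
    rw [this, zeroExt_eq_inner, real_inner_comm, inner_kerVec]
  rw [kerExt, h, zeroExt_eq_inner]

/-- A curve in a Hilbert space is differentiable if the second order difference quotients of its
Gram kernel converge. -/
theorem exists_hasDerivAt_of_gram {γ : ℝ → H} {c : ℝ}
    (h : ∀ ε > 0, ∃ δ > 0, ∀ s r : ℝ, s ≠ 0 → r ≠ 0 → |s| < δ → |r| < δ →
      |inner ℝ (γ s - γ 0) (γ r - γ 0) / (s * r) - c| ≤ ε) :
    ∃ ψ : H, HasDerivAt γ ψ 0 := by
  have hD : ∀ s r : ℝ, inner ℝ (s⁻¹ • (γ s - γ 0)) (r⁻¹ • (γ r - γ 0)) =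
      inner ℝ (γ s - γ 0) (γ r - γ 0) / (s * r) := by
    intro s r
    rw [real_inner_smul_left, real_inner_smul_right, div_eq_mul_inv, mul_inv]; ring
  have hc : Cauchy (Filter.map (slope γ 0) (𝓝[≠] (0 : ℝ))) := by
    rw [Metric.cauchy_iff]
    refine ⟨inferInstance, fun ε hε => ?_⟩
    obtain ⟨δ, hδ, H1⟩ := h (ε ^ 2 / 8) (by positivity)
    refine ⟨slope γ 0 '' {s | s ≠ 0 ∧ |s| < δ}, Filter.image_mem_map ?_, ?_⟩
    · filter_upwards [self_mem_nhdsWithin,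
        mem_nhdsWithin_of_mem_nhds (Metric.ball_mem_nhds (0 : ℝ) hδ)] with s h1 h2
      exact ⟨h1, by simpa using h2⟩
    · rintro _ ⟨s, ⟨hs, hs'⟩, rfl⟩ _ ⟨r, ⟨hr, hr'⟩, rfl⟩
      rw [dist_eq_norm]
      have e1 := H1 s s hs hs hs' hs'
      have e2 := H1 s r hs hr hs' hr'
      have e3 := H1 r r hr hr hr' hr'
      rw [← hD] at e1 e2 e3
      have : ‖slope γ 0 s - slope γ 0 r‖ ^ 2 < ε ^ 2 := by
        simp only [slope, vsub_eq_sub, sub_zero]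
        rw [norm_sub_sq_real, ← real_inner_self_eq_norm_sq, ← real_inner_self_eq_norm_sq]
        rw [abs_le] at e1 e2 e3
        have : 0 < ε ^ 2 := by positivity
        linarith
      exact lt_of_pow_lt_pow_left₀ 2 hε.le this
  obtain ⟨ψ, hψ⟩ := CompleteSpace.complete hc
  exact ⟨ψ, hasDerivAt_iff_tendsto_slope.mpr hψ⟩

theorem mvt_uIcc {F F' : ℝ → ℝ} {s : ℝ} (hs : s ≠ 0)
    (hF : ∀ u ∈ Set.uIcc 0 s, HasDerivAt F (F' u) u) :
    ∃ u ∈ Set.uIcc 0 s, F s - F 0 = s * F' u := by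
  rcases lt_or_gt_of_ne hs with h | h
  · rw [Set.uIcc_of_ge h.le] at hF ⊢
    obtain ⟨u, hu, he⟩ := exists_hasDerivAt_eq_slope F F' h
      (fun u hu => (hF u hu).continuousAt.continuousWithinAt)
      (fun u hu => hF u (Set.Ioo_subset_Icc_self hu))
    refine ⟨u, Set.Ioo_subset_Icc_self hu, ?_⟩
    rw [he]; field_simp; ring
  · rw [Set.uIcc_of_le h.le] at hF ⊢
    obtain ⟨u, hu, he⟩ := exists_hasDerivAt_eq_slope F F' h
      (fun u hu => (hF u hu).continuousAt.continuousWithinAt)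
      (fun u hu => hF u (Set.Ioo_subset_Icc_self hu))
    refine ⟨u, Set.Ioo_subset_Icc_self hu, ?_⟩
    rw [he]; field_simp; ring

/-- The second order difference quotients of a `C²` function of two variables converge. -/
theorem gram_quotient {E : Type*} [NormedAddCommGroup E] [NormedSpace ℝ E] {g : E × E → ℝ}
    {p : E × E} (hg : ContDiffAt ℝ 2 g p) (e : E) :
    ∀ ε > 0, ∃ δ > 0, ∀ s r : ℝ, s ≠ 0 → r ≠ 0 → |s| < δ → |r| < δ →
      |(g (p + (s • e, r • e)) - g (p + (s • e, 0)) - g (p + (0, r • e)) + g p) / (s * r) -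
        fderiv ℝ (fderiv ℝ g) p (0, e) (e, 0)| ≤ ε := by
  intro ε hε
  have h1 : ContDiffAt ℝ 1 (fderiv ℝ g) p := hg.fderiv_right (by norm_num)
  have h2 : ContinuousAt (fun z => fderiv ℝ (fderiv ℝ g) z (0, e) (e, 0)) p := by
    have : ContDiffAt ℝ 0 (fderiv ℝ (fderiv ℝ g)) p := h1.fderiv_right (by norm_num)
    exact (this.continuousAt.clm_apply continuousAt_const).clm_apply continuousAt_const
  have hev : ∀ᶠ z in 𝓝 p, DifferentiableAt ℝ g z ∧ DifferentiableAt ℝ (fderiv ℝ g) z ∧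
      |fderiv ℝ (fderiv ℝ g) z (0, e) (e, 0) - fderiv ℝ (fderiv ℝ g) p (0, e) (e, 0)| ≤ ε := by
    have a1 : ∀ᶠ z in 𝓝 p, ContDiffAt ℝ 2 g z := hg.eventually (by simp)
    filter_upwards [a1, h2.eventually (Metric.closedBall_mem_nhds _ hε)] with z hz hz'
    refine ⟨hz.differentiableAt (by norm_num), ?_, by simpa [Real.dist_eq] using hz'⟩
    exact (hz.fderiv_right (m := 1) (by norm_num)).differentiableAt (by norm_num)
  have hcont : ContinuousAt (fun q : ℝ × ℝ => p + (q.1 • e, q.2 • e)) (0, 0) := by fun_prop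
  have hev2 := (show Tendsto (fun q : ℝ × ℝ => p + (q.1 • e, q.2 • e)) (𝓝 (0, 0)) (𝓝 p) by
    have hp : p + ((0 : ℝ) • e, (0 : ℝ) • e) = p := by ext <;> simp
    simpa only [ContinuousAt, hp] using hcont).eventually hev
  obtain ⟨δ, hδ, hB⟩ := Metric.eventually_nhds_iff.mp hev2
  refine ⟨δ, hδ, fun s r hs hr hs' hr' => ?_⟩
  have hin : ∀ u v : ℝ, |u| < δ → |v| < δ → _ := fun u v hu hv =>
    @hB (u, v) (by simpa [Prod.dist_eq, Real.dist_eq] using ⟨hu, hv⟩)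
  have hder : ∀ u v : ℝ, |u| < δ → |v| < δ →
      HasDerivAt (fun u => g (p + (u • e, v • e))) (fderiv ℝ g (p + (u • e, v • e)) (e, 0)) u := by
    intro u v hu hv
    have := (hin u v hu hv).1.hasFDerivAt
    have hl : HasDerivAt (fun u : ℝ => p + (u • e, v • e)) (e, 0) u := by
      have := ((hasDerivAt_id u).smul_const e).prodMk (hasDerivAt_const u (v • e))
      simpa using this.const_add p
    exact this.comp_hasDerivAt u hl
  have hder2 : ∀ u v : ℝ, |u| < δ → |v| < δ →
      HasDerivAt (fun v => fderiv ℝ g (p + (u • e, v • e)) (e, 0))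
        (fderiv ℝ (fderiv ℝ g) (p + (u • e, v • e)) (0, e) (e, 0)) v := by
    intro u v hu hv
    have := (hin u v hu hv).2.1.hasFDerivAt
    have hl : HasDerivAt (fun v : ℝ => p + (u • e, v • e)) (0, e) v := by
      have := (hasDerivAt_const v (u • e)).prodMk ((hasDerivAt_id v).smul_const e)
      simpa using this.const_add p
    have h3 := this.comp_hasDerivAt v hl
    simpa using h3.clm_apply (hasDerivAt_const v ((e, 0) : E × E))
  have habs : ∀ {s u : ℝ}, |s| < δ → u ∈ Set.uIcc 0 s → |u| < δ := by
    intro s u hs hu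
    have := Set.abs_sub_left_of_mem_uIcc hu
    simp only [sub_zero] at this
    exact this.trans_lt hs
  have key : ∃ u ∈ Set.uIcc 0 s,
      (g (p + (s • e, r • e)) - g (p + (s • e, 0))) - (g (p + (0, r • e)) - g p) =
        s * (fderiv ℝ g (p + (u • e, r • e)) (e, 0) -
          fderiv ℝ g (p + (u • e, (0 : ℝ) • e)) (e, 0)) := by
    have hd : ∀ u ∈ Set.uIcc 0 s, HasDerivAt
        (fun u => g (p + (u • e, r • e)) - g (p + (u • e, (0 : ℝ) • e)))
        (fderiv ℝ g (p + (u • e, r • e)) (e, 0) -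
          fderiv ℝ g (p + (u • e, (0 : ℝ) • e)) (e, 0)) u := fun u hu =>
      (hder u r (habs hs' hu) hr').sub (hder u 0 (habs hs' hu) (by simpa using hδ))
    obtain ⟨u, hu, he⟩ := mvt_uIcc hs hd
    have hp : p + ((0 : E), (0 : E)) = p := by ext <;> simp
    exact ⟨u, hu, by simpa only [zero_smul, hp] using he⟩
  obtain ⟨u, hu, he⟩ := key
  obtain ⟨v, hv, he'⟩ := mvt_uIcc hr (fun v hv => hder2 u v (habs hs' hu) (habs hr' hv))
  have hfin := (hin u v (habs hs' hu) (habs hr' hv)).2.2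
  have : (g (p + (s • e, r • e)) - g (p + (s • e, 0)) - g (p + (0, r • e)) + g p) / (s * r) =
      fderiv ℝ (fderiv ℝ g) (p + (u • e, v • e)) (0, e) (e, 0) := by
    rw [div_eq_iff (mul_ne_zero hs hr)]
    rw [he'] at he
    linear_combination he
  rw [this]
  exact hfin

theorem exists_hasDerivAt_kerVec (hk : KernelC2 (X := X) H) (e x : EuclideanSpace ℝ (Fin d))
    (hx : x ∈ interior X) :
    ∃ ψ : H, HasDerivAt (fun t : ℝ => zeroExt X (kerVec H) (x + t • e)) ψ 0 := by
  have hg : ContDiffAt ℝ 2 (kerExt (X := X) H) (x, x) := by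
    refine hk.2.1.contDiffAt (isOpen_interior.mem_nhds ?_)
    rw [interior_prod_eq]; exact ⟨hx, hx⟩
  refine exists_hasDerivAt_of_gram
    (c := fderiv ℝ (fderiv ℝ (kerExt (X := X) H)) (x, x) (0, e) (e, 0)) fun ε hε => ?_
  obtain ⟨δ, hδ, h⟩ := gram_quotient hg e ε hε
  refine ⟨δ, hδ, fun s r hs hr hs' hr' => ?_⟩
  convert h s r hs hr hs' hr' using 4
  simp only [kerExt_eq_inner, Prod.mk_add_mk, add_zero, zero_smul, inner_sub_left,
    inner_sub_right]
  ring

theorem exists_kerDeriv_interior (hk : KernelC2 (X := X) H) (e : EuclideanSpace ℝ (Fin d)) :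
    ∃ ψ : EuclideanSpace ℝ (Fin d) → H,
      (∀ z ∈ interior X, ∀ f : H,
        HasDerivAt (fun t : ℝ => zeroExt X (f : X → ℝ) (z + t • e)) (inner ℝ (ψ z) f) 0) ∧
      ∀ z ∈ interior X, ∀ w ∈ interior X, inner ℝ (ψ z) (ψ w) =
        fderiv ℝ (fderiv ℝ (kerExt (X := X) H)) (z, w) (e, 0) (0, e) := by
  classical
  have hex : ∀ z, ∃ ψ : H, z ∈ interior X →
      HasDerivAt (fun t : ℝ => zeroExt X (kerVec H) (z + t • e)) ψ 0 := by
    intro z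
    by_cases hz : z ∈ interior X
    · obtain ⟨ψ, h⟩ := exists_hasDerivAt_kerVec hk e z hz
      exact ⟨ψ, fun _ => h⟩
    · exact ⟨0, fun h => absurd h hz⟩
  choose ψ hψ using hex
  have hfirst : ∀ z ∈ interior X, ∀ f : H,
      HasDerivAt (fun t : ℝ => zeroExt X (f : X → ℝ) (z + t • e)) (inner ℝ (ψ z) f) 0 := by
    intro z hz f
    have := (hψ z hz).inner ℝ (hasDerivAt_const (0 : ℝ) f)
    simpa only [zeroExt_eq_inner f, inner_zero_right, zero_add] using this
  refine ⟨ψ, hfirst, fun z hz w hw => ?_⟩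
  have hC : ∀ z ∈ interior X, ∀ w ∈ interior X,
      ContDiffAt ℝ 2 (kerExt (X := X) H) (z, w) := by
    intro z hz w hw
    refine hk.2.1.contDiffAt (isOpen_interior.mem_nhds ?_)
    rw [interior_prod_eq]; exact ⟨hz, hw⟩
  have hline : ∀ z : EuclideanSpace ℝ (Fin d), HasDerivAt (fun t : ℝ => z + t • e) e 0 := by
    intro z
    simpa using ((hasDerivAt_id (0 : ℝ)).smul_const e).const_add z
  have h1 : ∀ z ∈ interior X, inner ℝ (zeroExt X (kerVec H) z) (ψ w) =
      fderiv ℝ (kerExt (X := X) H) (z, w) (0, e) := by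
    intro z hz
    have a1 : HasDerivAt (fun t : ℝ => kerExt (X := X) H (z, w + t • e))
        (inner ℝ (zeroExt X (kerVec H) z) (ψ w)) 0 := by
      have := (hasDerivAt_const (0 : ℝ) (zeroExt X (kerVec H) z)).inner ℝ (hψ w hw)
      simpa only [kerExt_eq_inner, inner_zero_left, add_zero] using this
    have a2 : HasDerivAt (fun t : ℝ => kerExt (X := X) H (z, w + t • e))
        (fderiv ℝ (kerExt (X := X) H) (z, w) (0, e)) 0 := by
      have hd : HasFDerivAt (kerExt (X := X) H) (fderiv ℝ (kerExt (X := X) H) (z, w))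
          (z, w + (0 : ℝ) • e) := by
        simpa using ((hC z hz w hw).differentiableAt (by norm_num)).hasFDerivAt
      exact hd.comp_hasDerivAt 0 ((hasDerivAt_const (0 : ℝ) z).prodMk (hline w))
    exact a1.unique a2
  have b1 : HasDerivAt (fun t : ℝ => inner ℝ (zeroExt X (kerVec H) (z + t • e)) (ψ w))
      (inner ℝ (ψ z) (ψ w)) 0 := by
    simpa only [inner_zero_right, zero_add] using
      (hψ z hz).inner ℝ (hasDerivAt_const (0 : ℝ) (ψ w))
  have b2 : HasDerivAt (fun t : ℝ => fderiv ℝ (kerExt (X := X) H) (z + t • e, w) (0, e))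
      (fderiv ℝ (fderiv ℝ (kerExt (X := X) H)) (z, w) (e, 0) (0, e)) 0 := by
    have hd : HasFDerivAt (fderiv ℝ (kerExt (X := X) H))
        (fderiv ℝ (fderiv ℝ (kerExt (X := X) H)) (z, w)) (z + (0 : ℝ) • e, w) := by
      simpa using (((hC z hz w hw).fderiv_right (m := 1) (by norm_num)).differentiableAt
        (by norm_num)).hasFDerivAt
    have h3 := hd.comp_hasDerivAt 0 ((hline z).prodMk (hasDerivAt_const (0 : ℝ) w))
    simpa using h3.clm_apply (hasDerivAt_const (0 : ℝ)
      ((0, e) : EuclideanSpace ℝ (Fin d) × EuclideanSpace ℝ (Fin d)))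
  refine b1.unique (b2.congr_of_eventuallyEq ?_)
  have : ∀ᶠ t : ℝ in 𝓝 0, z + t • e ∈ interior X := by
    refine (hline z).continuousAt.eventually_mem (isOpen_interior.mem_nhds ?_)
    simpa using hz
  filter_upwards [this] with t ht
  exact h1 _ ht

/-- The partial derivatives of all functions in `H` at a point are represented by one element. -/
theorem exists_partialDeriv_repr (hX : closure X = closure (interior X))
    (hk : KernelC2 (X := X) H) (a : Fin d) (x : X) :
    ∃ g : H, ∀ f : H, partialDeriv a (f : X → ℝ) x = inner ℝ g f := by
  obtain ⟨ψ, h1, h2⟩ := exists_kerDeriv_interior hk (EuclideanSpace.single a (1 : ℝ))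
  set e : EuclideanSpace ℝ (Fin d) := EuclideanSpace.single a (1 : ℝ) with he
  have hl : ∀ f : H, ∀ z ∈ interior X,
      lineDeriv ℝ (zeroExt X (f : X → ℝ)) z e = inner ℝ (ψ z) f := fun f z hz =>
    (h1 z hz f).deriv
  by_cases hx : (x : EuclideanSpace ℝ (Fin d)) ∈ interior X
  · refine ⟨ψ x, fun f => ?_⟩
    rw [partialDeriv, if_pos hx, ← he, hl f x hx]
  · have hne : (𝓝[interior X] (x : EuclideanSpace ℝ (Fin d))).NeBot := by
      rw [← mem_closure_iff_nhdsWithin_neBot, ← hX]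
      exact subset_closure x.2
    obtain ⟨G, hG, hGe⟩ := hk.2.2.2
    have hc : Cauchy (Filter.map ψ (𝓝[interior X] (x : EuclideanSpace ℝ (Fin d)))) := by
      rw [Metric.cauchy_iff]
      refine ⟨inferInstance, fun ε hε => ?_⟩
      have hGc : ContinuousWithinAt (fun p => G p (e, 0) (0, e)) (X ×ˢ X) ((x : _), (x : _)) :=
        ((hG _ ⟨x.2, x.2⟩).clm_apply continuousWithinAt_const).clm_apply continuousWithinAt_const
      obtain ⟨δ, hδ, hB⟩ := Metric.continuousWithinAt_iff.mp hGc (ε ^ 2 / 8) (by positivity)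
      refine ⟨ψ '' (interior X ∩ Metric.ball (x : _) δ), Filter.image_mem_map
        (inter_mem self_mem_nhdsWithin
          (mem_nhdsWithin_of_mem_nhds (Metric.ball_mem_nhds _ hδ))), ?_⟩
      have hp : ∀ z ∈ interior X ∩ Metric.ball (x : EuclideanSpace ℝ (Fin d)) δ,
          ∀ w ∈ interior X ∩ Metric.ball (x : EuclideanSpace ℝ (Fin d)) δ,
          |inner ℝ (ψ z) (ψ w) - G (x, x) (e, 0) (0, e)| < ε ^ 2 / 8 := by
        intro z hz w hw
        have := @hB (z, w) ⟨interior_subset hz.1, interior_subset hw.1⟩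
          (by rw [Prod.dist_eq]; exact max_lt hz.2 hw.2)
        rwa [Real.dist_eq, hGe (by rw [interior_prod_eq]; exact ⟨hz.1, hw.1⟩),
          ← h2 z hz.1 w hw.1] at this
      rintro _ ⟨z, hz, rfl⟩ _ ⟨w, hw, rfl⟩
      rw [dist_eq_norm]
      have : ‖ψ z - ψ w‖ ^ 2 < ε ^ 2 := by
        rw [norm_sub_sq_real, ← real_inner_self_eq_norm_sq, ← real_inner_self_eq_norm_sq]
        have e1 := abs_lt.mp (hp z hz z hz)
        have e2 := abs_lt.mp (hp z hz w hw)
        have e3 := abs_lt.mp (hp w hw w hw)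
        have : 0 < ε ^ 2 := by positivity
        linarith
      exact lt_of_pow_lt_pow_left₀ 2 hε.le this
    obtain ⟨g, hg⟩ := CompleteSpace.complete hc
    refine ⟨g, fun f => ?_⟩
    rw [partialDeriv, if_neg hx, ← he]
    refine Tendsto.limUnder_eq ?_
    have ht : Tendsto (fun z => inner ℝ (ψ z) f)
        (𝓝[interior X] (x : EuclideanSpace ℝ (Fin d))) (𝓝 (inner ℝ g f)) :=
      (show Tendsto ψ _ (𝓝 g) from hg).inner tendsto_const_nhds
    refine ht.congr' ?_
    filter_upwards [self_mem_nhdsWithin] with z hz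
    exact (hl f z hz).symm

/-- The function `t ↦ ∂k(s, t)/∂sᵃ` at `s = x` belongs to `H`. -/
theorem kerDeriv_apply (hX : closure X = closure (interior X))
    (hk : KernelC2 (X := X) H) (a : Fin d) (x t : X) :
    kerDeriv H a x t = partialDeriv a (fun s => kerVal H s t) x := by
  refine Classical.epsilon_spec
    (p := fun g : H => ∀ t : X, g t = partialDeriv a (fun s => kerVal H s t) x) ?_ t
  obtain ⟨g, hg⟩ := exists_partialDeriv_repr hX hk a x
  refine ⟨g, fun t => ?_⟩
  simp only [kerVal_eq']
  rw [hg, real_inner_comm, inner_kerVec]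

/-- `∂f(x)/∂xᵃ = ⟨f, (∂ₐk)_x⟩` for all `f` in `H`. -/
theorem partialDeriv_eq_inner (hX : closure X = closure (interior X))
    (hk : KernelC2 (X := X) H) (a : Fin d) (x : X) (f : H) :
    partialDeriv a (f : X → ℝ) x = inner ℝ f (kerDeriv H a x) := by
  obtain ⟨g, hg⟩ := exists_partialDeriv_repr hX hk a x
  have : kerDeriv H a x = g := by
    refine RKHS.ext fun t => ?_
    rw [kerDeriv_apply hX hk]
    simp only [kerVal_eq']
    rw [hg, real_inner_comm, inner_kerVec]
  rw [this, hg, real_inner_comm]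

end Derivatives

/-! ### Sampling operator, empirical derivatives, and the regularized functional -/

section Functional

variable {d n : ℕ} [NeZero n] {X : Set (EuclideanSpace ℝ (Fin d))}
variable (H : Type*) [NormedAddCommGroup H] [InnerProductSpace ℝ H] [CompleteSpace H]
variable [RKHS ℝ H X ℝ]

/-- The sampling operator `(S f)ᵢ = ⟨f, k_{xᵢ}⟩`. -/
def sampling (x : Fin n → X) : H →L[ℝ] EmpVec n :=
  (EmpVec.ofFun n).comp (ContinuousLinearMap.pi fun i => innerSL ℝ (kerVec H (x i)))

/-- The empirical partial derivative `(D̂ₐ f)ᵢ = ⟨f, (∂ₐk)_{xᵢ}⟩`. -/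
def empDeriv (x : Fin n → X) (a : Fin d) : H →L[ℝ] EmpVec n :=
  (EmpVec.ofFun n).comp (ContinuousLinearMap.pi fun i => innerSL ℝ (kerDeriv H a (x i)))

/-- The empirical gradient `∇̂ f = (D̂ₐ f)ₐ`. -/
def empGrad (x : Fin n → X) : H →L[ℝ] GradVec d n :=
  ((PiLp.continuousLinearEquiv 2 ℝ fun _ : Fin d => EmpVec n).symm :
    (Fin d → EmpVec n) →L[ℝ] GradVec d n).comp
      (ContinuousLinearMap.pi fun a => empDeriv H x a)

/-- The empirical risk `Ê(f) = (1/n) ∑ᵢ (yᵢ - f(xᵢ))²`. -/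
def empRisk (x : Fin n → X) (y : Fin n → ℝ) (f : H) : ℝ :=
  (1 / (n : ℝ)) * ∑ i, (y i - f (x i)) ^ 2

/-- The regularizer `Ω̂(f) = ∑ₐ ‖∂f/∂xᵃ‖ₙ`. -/
def empReg (x : Fin n → X) (f : H) : ℝ :=
  ∑ a : Fin d, Real.sqrt ((1 / (n : ℝ)) * ∑ i, (partialDeriv a (f : X → ℝ) (x i)) ^ 2)

/-- The regularized functional `Ê(f) + τ (2 Ω̂(f) + ν ‖f‖²)`. -/
def objective (x : Fin n → X) (y : Fin n → ℝ) (τ ν : ℝ) (f : H) : ℝ :=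
  empRisk H x y f + τ * (2 * empReg H x f + ν * ‖f‖ ^ 2)

end Functional

/-! ### The algorithm -/

section Algorithm

variable {d n : ℕ} [NeZero n] {X : Set (EuclideanSpace ℝ (Fin d))}
variable (H : Type*) [NormedAddCommGroup H] [InnerProductSpace ℝ H] [CompleteSpace H]
variable [RKHS ℝ H X ℝ]

/-- The matrix of `S S*`. -/
def matK (x : Fin n → X) : Matrix (Fin n) (Fin n) ℝ :=
  fun i j => (1 / (n : ℝ)) * kerVal H (x i) (x j)

/-- The matrix of `S D̂ₐ*`: the entries are `(1/n) ∂k(s, xᵢ)/∂sᵃ` at `s = xⱼ`. -/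
def matZ (x : Fin n → X) (a : Fin d) : Matrix (Fin n) (Fin n) ℝ :=
  fun i j => (1 / (n : ℝ)) * partialDeriv a (fun s => kerVal H s (x i)) (x j)

/-- The matrix of `D̂ₐ D̂_b*`: the entries are `(1/n) ∂²k(u, s)/∂uᵃ∂sᵇ` at `u = xᵢ`, `s = xⱼ`. -/
def matL (x : Fin n → X) (a b : Fin d) : Matrix (Fin n) (Fin n) ℝ :=
  fun i j => (1 / (n : ℝ)) *
    partialDeriv a (fun u => partialDeriv b (fun s => kerVal H u s) (x j)) (x i)

/-- The sequence `s₁ = 1`, `sₜ = (1 + √(1 + 4 sₜ₋₁²)) / 2` (the value at `0` is not used). -/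
def fistaSeq : ℕ → ℝ
  | 0 => 1
  | 1 => 1
  | t + 2 => (1 + Real.sqrt (1 + 4 * fistaSeq (t + 1) ^ 2)) / 2

/-- The extrapolated point
`ũᵗ = (1 + (sₜ₋₁ - 1)/sₜ) uᵗ⁻¹ + ((1 - sₜ₋₁)/sₜ) uᵗ⁻²`, for `t ≥ 2`. -/
def extrapolate {V : Type*} [AddCommGroup V] [Module ℝ V] (u : ℕ → V) (t : ℕ) : V :=
  (1 + (fistaSeq (t - 1) - 1) / fistaSeq t) • u (t - 1) +
    ((1 - fistaSeq (t - 1)) / fistaSeq t) • u (t - 2)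

/-- The projection of `ℝⁿ` onto the ball of radius `r` for `‖·‖ₙ`. -/
def ballProj (r : ℝ) (w : EmpVec n) : EmpVec n :=
  open Classical in if ‖w‖ ≤ r then w else (r / ‖w‖) • w

/-- One step of the inner iteration: for `α = αᵗ` and `b = β̃ᵗ`, the vector with components
`π(vₐ - (1/η)(Lₐ v - (Zₐᵀ α + (1 - τν/σ) Lₐ b)))`, with `π` the projection onto the ball of
radius `τ/σ`. -/
def innerStep (x : Fin n → X) (τ ν σ η : ℝ) (α : EmpVec n) (b v : GradVec d n) : GradVec d n :=
  WithLp.toLp 2 fun a => ballProj (τ / σ) <| v a - (1 / η) • EmpVec.ofFun n fun i =>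
    (∑ c, (matL H x a c).mulVec (v c).coord i) -
      ((matZ H x a).transpose.mulVec α.coord i +
        (1 - τ * ν / σ) * ∑ c, (matL H x a c).mulVec (b c).coord i)

/-- `(α, β, v̄)` are the sequences generated by the algorithm when `q t` inner steps are made at the
outer step `t`; the inner iteration at step `t` starts from `v̄ᵗ⁻¹`. -/
structure IsAlgorithmRun (x : Fin n → X) (y : Fin n → ℝ) (τ ν σ η : ℝ) (q : ℕ → ℕ)
    (α : ℕ → EmpVec n) (β vbar : ℕ → GradVec d n) : Prop where
  alpha_zero : α 0 = 0
  alpha_one : α 1 = 0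
  beta_zero : β 0 = 0
  beta_one : β 1 = 0
  vbar_one : vbar 1 = 0
  alpha_step : ∀ t, 2 ≤ t → ∀ i, α t i = (1 - τ * ν / σ) * extrapolate α t i -
    (1 / σ) * ((matK H x).mulVec (extrapolate α t).coord i +
      (∑ a, (matZ H x a).mulVec (extrapolate β t a).coord i) - y i)
  vbar_step : ∀ t, 2 ≤ t →
    vbar t = (innerStep H x τ ν σ η (α t) (extrapolate β t))^[q t] (vbar (t - 1))
  beta_step : ∀ t, 2 ≤ t → β t = (1 - τ * ν / σ) • extrapolate β t - vbar t

/-- The function `(1/n) ∑ᵢ αᵢ k_{xᵢ} + (1/n) ∑ᵢ ∑ₐ βₐᵢ (∂ₐk)_{xᵢ}` with coefficients `α`, `β`. -/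
def funOfCoeff (x : Fin n → X) (α : EmpVec n) (β : GradVec d n) : H :=
  (1 / (n : ℝ)) • ∑ i, α i • kerVec H (x i) +
    (1 / (n : ℝ)) • ∑ i, ∑ a, β a i • kerDeriv H a (x i)

/-- The tolerance `ε̃ᵗ`, with
`(ε̃ᵗ)² = (εᵗ)² + √(C/(τν)) ((τ/σ) ∑ₐ √‖D̂ₐ* D̂ₐ‖ + 1) 4/t`. -/
def epsTilde (x : Fin n → X) (τ ν σ C : ℝ) (ε : ℕ → ℝ) (t : ℕ) : ℝ :=
  Real.sqrt (ε t ^ 2 + Real.sqrt (C / (τ * ν)) *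
    (τ / σ * ∑ a, Real.sqrt ‖(ContinuousLinearMap.adjoint (empDeriv H x a)).comp (empDeriv H x a)‖
      + 1) * (4 / (t : ℝ)))

end Algorithm

end

/-! ### The accelerated proximal gradient method with errors -/

/-! Both claims rest on the duality gap `r Ω̂(f) - ⟨∇̂* v, f⟩` with `r = τ/σ` and `v` in the product
of balls of radius `r`. By Cauchy–Schwarz it is a sum of nonnegative terms, one for each variable,
and the term of `a` is at least `(r - ‖vₐ‖) ‖D̂ₐ f‖` (`gap_component_le`). A small gap at the
minimizer therefore forces `D̂ₐ f̂` to vanish wherever `‖vₐ‖` stays sufficiently below `r`.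

For (1), the gap at the minimizer is at most zero: `Ω̂` is positively homogeneous, so comparing the
minimizer with its own contractions `(1 - s) f̂` already gives the needed optimality inequality.

For (2), the coefficient recursion is, inside `H`, an accelerated proximal gradient method in which
the proximal point is replaced by subtraction of `∇̂* v̄ᵗ`. The inner loop enters through two facts
only: `v̄ᵗ` lies in the product of balls, and its gap at `fᵗ` is at most `(εᵗ)²/2`. Together they
make `∇̂* v̄ᵗ` an approximate subgradient, hence an inexact proximal inequality
(`inexact_prox_step`). An energy argument then gives the rate `C/t²`, the errors being summable
against `t²` because `l > 3/2` (`exists_fista_rate`). The term `τν‖f‖²` provides quadratic growth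
(`ridge_strong_growth`), so `‖fᵗ - f̂‖ ≤ √(C/(τν))/t`. Moving the gap from `fᵗ` to the minimizer
costs a multiple of this distance (`gap_le_gap_add`), and the result lies below `(ε̃ᵗ)²/2`. A
nonvanishing derivative, of norm at least `m`, would make the gap larger. -/

theorem fistaSeq_one_le (t : ℕ) : 1 ≤ fistaSeq t := by
  match t with
  | 0 => exact le_rfl
  | 1 => exact le_rfl
  | t + 2 =>
    have h : (1 : ℝ) ≤ Real.sqrt (1 + 4 * fistaSeq (t + 1) ^ 2) :=
      Real.one_le_sqrt.mpr (by nlinarith [sq_nonneg (fistaSeq (t + 1))])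
    rw [fistaSeq]
    linarith

/-- The recursion picks the positive root of `s² - s = sₜ₋₁²`; this relation makes the energies
telescope. -/
theorem fistaSeq_sq_sub (t : ℕ) :
    fistaSeq (t + 2) ^ 2 - fistaSeq (t + 2) = fistaSeq (t + 1) ^ 2 := by
  rw [fistaSeq]
  have h := Real.sq_sqrt (show (0 : ℝ) ≤ 1 + 4 * fistaSeq (t + 1) ^ 2 by positivity)
  linear_combination h / 4

/-- Each increment is at most 1, since `√(1 + 4s²) ≤ 1 + 2s`. This lets the error weights `sₜ²` be
replaced by `t²`. -/
theorem fistaSeq_le (t : ℕ) : fistaSeq (t + 1) ≤ t + 1 := by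
  induction t with
  | zero => simp [fistaSeq]
  | succ t ih =>
    have h1 := fistaSeq_one_le (t + 1)
    have h : Real.sqrt (1 + 4 * fistaSeq (t + 1) ^ 2) ≤ 1 + 2 * fistaSeq (t + 1) := by
      rw [Real.sqrt_le_left (by linarith)]
      nlinarith
    rw [fistaSeq]
    push_cast
    linarith

/-- Each increment is at least 1/2, since `√(1 + 4s²) ≥ 2s`. The quadratic rate comes from here. -/
theorem le_fistaSeq (t : ℕ) : ((t : ℝ) + 1) / 2 ≤ fistaSeq (t + 1) := by
  induction t with
  | zero => norm_num [fistaSeq]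
  | succ t ih =>
    have h1 := fistaSeq_one_le (t + 1)
    have h : 2 * fistaSeq (t + 1) ≤ Real.sqrt (1 + 4 * fistaSeq (t + 1) ^ 2) :=
      Real.le_sqrt_of_sq_le (by nlinarith)
    rw [fistaSeq]
    push_cast
    linarith

section Fista

variable {V : Type*} [NormedAddCommGroup V] [InnerProductSpace ℝ V]

/-- One step of the energy estimate of the accelerated method. -/
theorem fista_energy_step {J : V → ℝ} (hJ : ConvexOn ℝ Set.univ J) {σ : ℝ} {f : ℕ → V} {z : V}
    {e : ℕ → ℝ} (t : ℕ)
    (hf : ∀ g, J (f (t + 2)) ≤ J g + σ * (‖extrapolate f (t + 2) - g‖ ^ 2 - ‖f (t + 2) - g‖ ^ 2) +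
      σ * e (t + 2)) :
    fistaSeq (t + 2) ^ 2 * (J (f (t + 2)) - J z) + σ * ‖fistaSeq (t + 2) • f (t + 2) -
        (fistaSeq (t + 2) - 1) • f (t + 1) - z‖ ^ 2 ≤
      fistaSeq (t + 1) ^ 2 * (J (f (t + 1)) - J z) + σ * ‖fistaSeq (t + 1) • f (t + 1) -
        (fistaSeq (t + 1) - 1) • f t - z‖ ^ 2 + σ * (fistaSeq (t + 2) ^ 2 * e (t + 2)) := by
  have h1 := fistaSeq_one_le (t + 2)
  have hs := fistaSeq_sq_sub t
  have hex : extrapolate f (t + 2) = (1 + (fistaSeq (t + 1) - 1) / fistaSeq (t + 2)) • f (t + 1) +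
      ((1 - fistaSeq (t + 1)) / fistaSeq (t + 2)) • f t := rfl
  rw [← hs]
  generalize fistaSeq (t + 2) = s at *
  generalize fistaSeq (t + 1) = r at *
  have hs0 : s ≠ 0 := by positivity
  have hinv : s⁻¹ ≤ 1 := inv_le_one_of_one_le₀ h1
  -- The proximal inequality is tested at a convex combination of the last iterate and `z`.
  have hcv : J ((1 - s⁻¹) • f (t + 1) + s⁻¹ • z) ≤ (1 - s⁻¹) * J (f (t + 1)) + s⁻¹ * J z :=
    hJ.2 trivial trivial (by linarith) (by positivity) (by ring)
  have hg := hf ((1 - s⁻¹) • f (t + 1) + s⁻¹ • z)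
  -- The extrapolation weights are chosen so that this scaled difference is exactly the vector in
  -- the previous energy.
  have e1 : r • f (t + 1) - (r - 1) • f t - z =
      s • (extrapolate f (t + 2) - ((1 - s⁻¹) • f (t + 1) + s⁻¹ • z)) := by
    rw [hex]
    match_scalars <;> field_simp
    · ring
    · ring
  have e2 : s • f (t + 2) - (s - 1) • f (t + 1) - z =
      s • (f (t + 2) - ((1 - s⁻¹) • f (t + 1) + s⁻¹ • z)) := by
    match_scalars <;> field_simp
  rw [e1, e2, norm_smul, norm_smul, mul_pow, mul_pow, Real.norm_eq_abs, sq_abs]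
  have h := mul_le_mul_of_nonneg_left (hg.trans (add_le_add_left (add_le_add_left hcv _) _))
    (sq_nonneg s)
  have e3 : s ^ 2 * ((1 - s⁻¹) * J (f (t + 1)) + s⁻¹ * J z) =
      (s ^ 2 - s) * J (f (t + 1)) + s * J z := by
    field_simp
  linarith

/-- The rate of convergence `O(1/t²)` of the accelerated method with summable errors. -/
theorem exists_fista_rate {J : V → ℝ} (hJ : ConvexOn ℝ Set.univ J) {σ : ℝ} (hσ : 0 < σ)
    {f : ℕ → V} {z : V} (hz : ∀ g, J z ≤ J g) {e : ℕ → ℝ} (he : ∀ t, 0 ≤ e t)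
    (hsum : Summable fun t : ℕ => (t : ℝ) ^ 2 * e t)
    (hf : ∀ t, 2 ≤ t → ∀ g, J (f t) ≤ J g +
      σ * (‖extrapolate f t - g‖ ^ 2 - ‖f t - g‖ ^ 2) + σ * e t) :
    ∃ C : ℝ, 0 < C ∧ ∀ t : ℕ, 2 ≤ t → J (f t) - J z ≤ C / (t : ℝ) ^ 2 := by
  set A : ℝ := (J (f 1) - J z) + σ * ‖f 1 - z‖ ^ 2 with hA
  have hterm : ∀ t : ℕ, 0 ≤ (t : ℝ) ^ 2 * e t := fun t => mul_nonneg (by positivity) (he t)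
  have hmain : ∀ t : ℕ, fistaSeq (t + 1) ^ 2 * (J (f (t + 1)) - J z) +
      σ * ‖fistaSeq (t + 1) • f (t + 1) - (fistaSeq (t + 1) - 1) • f t - z‖ ^ 2 ≤
      A + σ * ∑ k ∈ Finset.range (t + 2), (k : ℝ) ^ 2 * e k := by
    intro t
    induction t with
    | zero =>
      -- As `s₁ = 1`, the coefficient of `f 0` vanishes and the initial energy is `A`.
      have h0 := mul_nonneg hσ.le (Finset.sum_nonneg fun k (_ : k ∈ Finset.range 2) => hterm k)
      simpa [fistaSeq, hA] using h0
    | succ t ih =>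
      have hstep := fista_energy_step hJ (z := z) t (hf (t + 2) (by omega))
      have hle := fistaSeq_le (t + 1)
      have hle' : fistaSeq (t + 2) ^ 2 * e (t + 2) ≤ ((t + 2 : ℕ) : ℝ) ^ 2 * e (t + 2) := by
        refine mul_le_mul_of_nonneg_right (pow_le_pow_left₀
          (zero_le_one.trans (fistaSeq_one_le _)) ?_ 2) (he _)
        push_cast at hle ⊢
        linarith
      rw [Finset.sum_range_succ _ (t + 2), mul_add]
      have := mul_le_mul_of_nonneg_left hle' hσ.le
      linarith
  have hS : ∀ t : ℕ, ∑ k ∈ Finset.range (t + 2), (k : ℝ) ^ 2 * e k ≤ ∑' k : ℕ, (k : ℝ) ^ 2 * e k :=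
    fun t => hsum.sum_le_tsum _ fun k _ => hterm k
  have hS0 : 0 ≤ ∑' k : ℕ, (k : ℝ) ^ 2 * e k := tsum_nonneg hterm
  have hA0 : 0 ≤ A := add_nonneg (sub_nonneg.mpr (hz _)) (by positivity)
  -- The factor 4 comes from `sₜ ≥ t/2`; the summand 1 makes the constant strictly positive.
  refine ⟨4 * (A + σ * ∑' k : ℕ, (k : ℝ) ^ 2 * e k) + 1, by positivity, fun t ht => ?_⟩
  obtain ⟨t, rfl⟩ : ∃ k, t = k + 1 := ⟨t - 1, by omega⟩
  rw [le_div_iff₀ (by positivity)]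
  have h1 := hmain t
  have h2 := mul_le_mul_of_nonneg_left (hS t) hσ.le
  have h3 : 0 ≤ σ * ‖fistaSeq (t + 1) • f (t + 1) - (fistaSeq (t + 1) - 1) • f t - z‖ ^ 2 := by
    positivity
  have h4 : (((t : ℝ) + 1) / 2) ^ 2 ≤ fistaSeq (t + 1) ^ 2 :=
    pow_le_pow_left₀ (by positivity) (le_fistaSeq t) 2
  have h5 := mul_le_mul_of_nonneg_right h4 (sub_nonneg.mpr (hz (f (t + 1))))
  push_cast
  linarith

end Fista

/-- Squares of tolerances of order `t⁻ˡ` with `l > 3/2` are summable against `t²`. -/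
theorem summable_sq_mul_sq_of_isBigO {ε : ℕ → ℝ} {l : ℝ} (hl : 3 / 2 < l)
    (hε : ε =O[atTop] fun t : ℕ => (t : ℝ) ^ (-l)) :
    Summable fun t : ℕ => (t : ℝ) ^ 2 * ε t ^ 2 := by
  -- The exponent is below -1 exactly when `l > 3/2`.
  have hs : Summable fun t : ℕ => (t : ℝ) ^ (2 - 2 * l) :=
    Real.summable_nat_rpow.mpr (by linarith)
  refine summable_of_isBigO_nat hs ?_
  refine ((Asymptotics.isBigO_refl (fun t : ℕ => (t : ℝ) ^ 2) atTop).mul (hε.pow 2)).trans_eventuallyEq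
    ?_
  filter_upwards [eventually_gt_atTop 0] with t ht
  have ht' : (0 : ℝ) < t := by exact_mod_cast ht
  rw [← Real.rpow_natCast, ← Real.rpow_natCast, ← Real.rpow_mul ht'.le, ← Real.rpow_add ht']
  congr 1
  push_cast
  ring

/-! ### Quadratic functionals -/

section Quadratic

variable {V E : Type*} [NormedAddCommGroup V] [InnerProductSpace ℝ V] [CompleteSpace V]
variable [NormedAddCommGroup E] [InnerProductSpace ℝ E] [CompleteSpace E]

/-- The gradient of `f ↦ ‖S f - y‖² + κ ‖f‖²`. -/
noncomputable def ridgeGrad (S : V →L[ℝ] E) (y : E) (κ : ℝ) (f : V) : V :=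
  (2 : ℝ) • ContinuousLinearMap.adjoint S (S f - y) + (2 * κ) • f

/-- The functional is quadratic, so its second-order Taylor formula is exact. The remainder gives
differentiability, an upper bound by `σ‖g - f‖²` when `σ` is large, and quadratic growth. -/
theorem ridge_expansion (S : V →L[ℝ] E) (y : E) (κ : ℝ) (f g : V) :
    ‖S g - y‖ ^ 2 + κ * ‖g‖ ^ 2 = ‖S f - y‖ ^ 2 + κ * ‖f‖ ^ 2 +
      inner ℝ (ridgeGrad S y κ f) (g - f) + (‖S (g - f)‖ ^ 2 + κ * ‖g - f‖ ^ 2) := by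
  have h1 : ‖S g - y‖ ^ 2 = ‖S f - y‖ ^ 2 + 2 * inner ℝ (S f - y) (S (g - f)) +
      ‖S (g - f)‖ ^ 2 := by
    rw [← norm_add_sq_real, map_sub]
    congr 2
    abel
  have h2 : ‖g‖ ^ 2 = ‖f‖ ^ 2 + 2 * inner ℝ f (g - f) + ‖g - f‖ ^ 2 := by
    rw [← norm_add_sq_real, add_sub_cancel]
  rw [ridgeGrad, inner_add_left, real_inner_smul_left, real_inner_smul_left,
    ContinuousLinearMap.adjoint_inner_left, h1, h2]
  ring

theorem hasGradientAt_ridge (S : V →L[ℝ] E) (y : E) (κ : ℝ) (f : V) :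
    HasGradientAt (fun f => ‖S f - y‖ ^ 2 + κ * ‖f‖ ^ 2) (ridgeGrad S y κ f) f := by
  rw [hasGradientAt_iff_isLittleO]
  have hO : (fun g : V => ‖S (g - f)‖ ^ 2 + κ * ‖g - f‖ ^ 2) =O[𝓝 f] fun g => ‖g - f‖ ^ 2 := by
    refine Asymptotics.IsBigO.add ?_ ((Asymptotics.isBigO_refl _ _).const_mul_left κ)
    exact (S.isBigO_sub _ f).norm_norm.pow 2 |>.congr_left fun g => by simp
  have ho := hO.trans_isLittleO (Asymptotics.isLittleO_pow_sub_sub f one_lt_two)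
  refine ho.congr_left fun g => ?_
  rw [ridge_expansion S y κ f g]
  ring

theorem norm_sq_le_norm_adjoint_comp (S : V →L[ℝ] E) (h : V) :
    ‖S h‖ ^ 2 ≤ ‖(ContinuousLinearMap.adjoint S).comp S‖ * ‖h‖ ^ 2 := by
  rw [← real_inner_self_eq_norm_sq, ← ContinuousLinearMap.adjoint_inner_left]
  refine (real_inner_le_norm _ _).trans ?_
  have := ((ContinuousLinearMap.adjoint S).comp S).le_opNorm h
  rw [ContinuousLinearMap.comp_apply] at this
  nlinarith [norm_nonneg h]

/-- The basic inequality of an inexact proximal gradient step for `‖S f - y‖² + κ ‖f‖² + R f`, when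
the proximal point is computed up to an approximate subgradient `p` of `R / (2σ)`. -/
theorem inexact_prox_step (S : V →L[ℝ] E) (y : E) {κ σ e : ℝ} (hκ : 0 ≤ κ)
    (hσ : ‖(ContinuousLinearMap.adjoint S).comp S‖ + κ ≤ σ) {R : V → ℝ} {f u p : V}
    (hfu : f = u - (1 / (2 * σ)) • ridgeGrad S y κ u - p) (hσ0 : 0 < σ)
    (hp : ∀ g, R f + 2 * σ * inner ℝ p (g - f) ≤ R g + σ * e) (g : V) :
    ‖S f - y‖ ^ 2 + κ * ‖f‖ ^ 2 + R f ≤ ‖S g - y‖ ^ 2 + κ * ‖g‖ ^ 2 + R g +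
      σ * (‖u - g‖ ^ 2 - ‖f - g‖ ^ 2) + σ * e := by
  have h1 := ridge_expansion S y κ u f
  have h2 := ridge_expansion S y κ u g
  -- The lower bound on `σ` is what controls the remainder at the new point; at `g` nonnegativity of
  -- the remainder suffices.
  have h3 : ‖S (f - u)‖ ^ 2 + κ * ‖f - u‖ ^ 2 ≤ σ * ‖f - u‖ ^ 2 := by
    have := norm_sq_le_norm_adjoint_comp S (f - u)
    nlinarith [sq_nonneg ‖f - u‖]
  have h4 : 0 ≤ ‖S (g - u)‖ ^ 2 + κ * ‖g - u‖ ^ 2 :=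
    add_nonneg (sq_nonneg _) (mul_nonneg hκ (sq_nonneg _))
  have hG : ridgeGrad S y κ u = (2 * σ) • (u - f - p) := by
    rw [hfu]
    match_scalars <;> field_simp <;> ring
  -- The three-point identity turns the inner product left by the gradient step into a difference of
  -- squared distances.
  have h5 : ‖u - g‖ ^ 2 = ‖f - u‖ ^ 2 + 2 * inner ℝ (u - f) (f - g) + ‖f - g‖ ^ 2 := by
    rw [norm_sub_rev f u, ← norm_add_sq_real]
    congr 2
    abel
  have h6 : inner ℝ (ridgeGrad S y κ u) (f - u) - inner ℝ (ridgeGrad S y κ u) (g - u) =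
      2 * σ * inner ℝ (u - f) (f - g) + 2 * σ * inner ℝ p (g - f) := by
    rw [← inner_sub_right, sub_sub_sub_cancel_right, hG, real_inner_smul_left, inner_sub_left,
      ← neg_sub g f, inner_neg_right p]
    ring
  have := hp g
  rw [h5]
  linarith

/-- Quadratic growth at a minimizer. -/
theorem ridge_strong_growth (S : V →L[ℝ] E) (y : E) {κ : ℝ} {R : V → ℝ}
    (hR : ConvexOn ℝ Set.univ R) {z : V}
    (hz : ∀ g, ‖S z - y‖ ^ 2 + κ * ‖z‖ ^ 2 + R z ≤ ‖S g - y‖ ^ 2 + κ * ‖g‖ ^ 2 + R g) (f : V) :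
    κ * ‖f - z‖ ^ 2 ≤
      (‖S f - y‖ ^ 2 + κ * ‖f‖ ^ 2 + R f) - (‖S z - y‖ ^ 2 + κ * ‖z‖ ^ 2 + R z) := by
  -- First-order optimality without subdifferentials: compare `z` with points of the segment towards
  -- `f`, divide by the step `r` and let `r → 0⁺`.
  have hfirst : 0 ≤ inner ℝ (ridgeGrad S y κ z) (f - z) + (R f - R z) := by
    set q := ‖S (f - z)‖ ^ 2 + κ * ‖f - z‖ ^ 2
    have hlim : Tendsto (fun r : ℝ => inner ℝ (ridgeGrad S y κ z) (f - z) + (R f - R z) + r * q)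
        (𝓝[>] 0) (𝓝 (inner ℝ (ridgeGrad S y κ z) (f - z) + (R f - R z) + 0 * q)) :=
      tendsto_nhdsWithin_of_tendsto_nhds (Continuous.tendsto (by fun_prop) 0)
    rw [zero_mul, add_zero] at hlim
    refine ge_of_tendsto hlim ?_
    filter_upwards [Ioo_mem_nhdsGT (zero_lt_one' ℝ)] with r hr
    have hcv : R ((1 - r) • z + r • f) ≤ (1 - r) * R z + r * R f :=
      hR.2 trivial trivial (by linarith [hr.2]) hr.1.le (by ring)
    have h1 := hz ((1 - r) • z + r • f)
    rw [ridge_expansion S y κ z ((1 - r) • z + r • f)] at h1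
    have e1 : (1 - r) • z + r • f - z = r • (f - z) := by module
    rw [e1, real_inner_smul_right, map_smul, norm_smul, norm_smul, mul_pow, mul_pow,
      Real.norm_eq_abs, sq_abs] at h1
    have : 0 ≤ r * (inner ℝ (ridgeGrad S y κ z) (f - z) + (R f - R z) + r * q) := by
      simp only [q]
      linarith
    exact nonneg_of_mul_nonneg_right this hr.1
  rw [ridge_expansion S y κ z f]
  nlinarith [sq_nonneg ‖S (f - z)‖]

end Quadratic

/-! ### The empirical operators -/

theorem EmpVec.sum_apply {n : ℕ} {ι : Type*} (s : Finset ι) (u : ι → EmpVec n) (i : Fin n) :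
    (∑ j ∈ s, u j) i = ∑ j ∈ s, u j i :=
  map_sum ({ toFun := fun v => v i, map_zero' := rfl, map_add' := fun _ _ => rfl } :
    EmpVec n →+ ℝ) u s

section Operators

variable {d n : ℕ} [NeZero n] {X : Set (EuclideanSpace ℝ (Fin d))}
variable {H : Type*} [NormedAddCommGroup H] [InnerProductSpace ℝ H] [CompleteSpace H]
variable [RKHS ℝ H X ℝ]

theorem sampling_apply (x : Fin n → X) (f : H) (i : Fin n) :
    sampling H x f i = inner ℝ (kerVec H (x i)) f := rfl

theorem empDeriv_apply (x : Fin n → X) (a : Fin d) (f : H) (i : Fin n) :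
    empDeriv H x a f i = inner ℝ (kerDeriv H a (x i)) f := rfl

theorem empGrad_apply (x : Fin n → X) (f : H) (a : Fin d) :
    empGrad H x f a = empDeriv H x a f := rfl

theorem adjoint_sampling_apply (x : Fin n → X) (α : EmpVec n) :
    ContinuousLinearMap.adjoint (sampling H x) α =
      (1 / (n : ℝ)) • ∑ i, α i • kerVec H (x i) := by
  refine ext_inner_right ℝ fun h => ?_
  simp only [ContinuousLinearMap.adjoint_inner_left, EmpVec.inner_def, sampling_apply,
    real_inner_smul_left, sum_inner]

theorem adjoint_empDeriv_apply (x : Fin n → X) (a : Fin d) (u : EmpVec n) :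
    ContinuousLinearMap.adjoint (empDeriv H x a) u =
      (1 / (n : ℝ)) • ∑ i, u i • kerDeriv H a (x i) := by
  refine ext_inner_right ℝ fun h => ?_
  simp only [ContinuousLinearMap.adjoint_inner_left, EmpVec.inner_def, empDeriv_apply,
    real_inner_smul_left, sum_inner]

theorem adjoint_empGrad_apply (x : Fin n → X) (v : GradVec d n) :
    ContinuousLinearMap.adjoint (empGrad H x) v =
      ∑ a, ContinuousLinearMap.adjoint (empDeriv H x a) (v a) := by
  refine ext_inner_right ℝ fun h => ?_
  simp only [ContinuousLinearMap.adjoint_inner_left, sum_inner, PiLp.inner_apply, empGrad_apply]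

theorem inner_adjoint_empGrad (x : Fin n → X) (v : GradVec d n) (f : H) :
    inner ℝ (ContinuousLinearMap.adjoint (empGrad H x) v) f =
      ∑ a, inner ℝ (v a) (empDeriv H x a f) := by
  simp only [ContinuousLinearMap.adjoint_inner_left, PiLp.inner_apply, empGrad_apply]

/-- Passing from coefficients to functions is the linear map `S* + ∇̂*`, so the recursion on
coefficients can be read in `H`. -/
theorem funOfCoeff_eq (x : Fin n → X) (α : EmpVec n) (β : GradVec d n) :
    funOfCoeff H x α β = ContinuousLinearMap.adjoint (sampling H x) α +
      ContinuousLinearMap.adjoint (empGrad H x) β := by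
  simp only [funOfCoeff, adjoint_sampling_apply, adjoint_empGrad_apply, adjoint_empDeriv_apply]
  rw [Finset.sum_comm, Finset.smul_sum (s := (Finset.univ : Finset (Fin d)))]

theorem matK_mulVec (x : Fin n → X) (α : EmpVec n) (i : Fin n) :
    (matK H x).mulVec α.coord i =
      sampling H x (ContinuousLinearMap.adjoint (sampling H x) α) i := by
  simp only [adjoint_sampling_apply, sampling_apply, real_inner_smul_right, inner_sum,
    Matrix.mulVec, dotProduct, matK, kerVal_eq, Finset.mul_sum]
  exact Finset.sum_congr rfl fun j _ => by ring

/-- The entries are values of `(∂ₐk)_{xⱼ}` at `xᵢ`, hence inner products with `k_{xᵢ}`; regularity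
of the kernel puts these derivatives in `H`. -/
theorem matZ_mulVec (hX : closure X = closure (interior X)) (hk : KernelC2 (X := X) H)
    (x : Fin n → X) (a : Fin d) (u : EmpVec n) (i : Fin n) :
    (matZ H x a).mulVec u.coord i =
      sampling H x (ContinuousLinearMap.adjoint (empDeriv H x a) u) i := by
  simp only [adjoint_empDeriv_apply, sampling_apply, real_inner_smul_right, inner_sum,
    Matrix.mulVec, dotProduct, matZ, ← kerDeriv_apply hX hk, inner_kerVec, Finset.mul_sum]
  exact Finset.sum_congr rfl fun j _ => by ring

theorem empRisk_eq (x : Fin n → X) (y : Fin n → ℝ) (f : H) :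
    empRisk H x y f = ‖sampling H x f - EmpVec.ofFun n y‖ ^ 2 := by
  rw [EmpVec.norm_def, Real.sq_sqrt (by positivity), empRisk]
  congr 1
  refine Finset.sum_congr rfl fun i _ => ?_
  rw [EmpVec.sub_apply, sampling_apply, inner_kerVec, EmpVec.ofFun_apply]
  ring

theorem empReg_eq (hX : closure X = closure (interior X)) (hk : KernelC2 (X := X) H)
    (x : Fin n → X) (f : H) : empReg H x f = ∑ a, ‖empDeriv H x a f‖ := by
  refine Finset.sum_congr rfl fun a _ => ?_
  rw [EmpVec.norm_def]
  simp only [partialDeriv_eq_inner hX hk, empDeriv_apply, real_inner_comm]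

theorem objective_eq (hX : closure X = closure (interior X)) (hk : KernelC2 (X := X) H)
    (x : Fin n → X) (y : Fin n → ℝ) (τ ν : ℝ) (f : H) :
    objective H x y τ ν f = ‖sampling H x f - EmpVec.ofFun n y‖ ^ 2 + τ * ν * ‖f‖ ^ 2 +
      2 * τ * ∑ a, ‖empDeriv H x a f‖ := by
  rw [objective, empRisk_eq, empReg_eq hX hk]
  ring

/-! ### Convexity of the objective, and the operator norms in the tolerance -/

theorem convexOn_sum_norm {V E : Type*} [NormedAddCommGroup V] [InnerProductSpace ℝ V]
    [NormedAddCommGroup E] [InnerProductSpace ℝ E] (D : Fin d → V →L[ℝ] E) {c : ℝ} (hc : 0 ≤ c) :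
    ConvexOn ℝ Set.univ fun f => c * ∑ a, ‖D a f‖ := by
  refine ⟨convex_univ, fun f _ g _ r s hr hs _ => ?_⟩
  have h : ∀ a, ‖D a (r • f + s • g)‖ ≤ r * ‖D a f‖ + s * ‖D a g‖ := fun a => by
    rw [map_add, map_smul, map_smul]
    refine (norm_add_le _ _).trans_eq ?_
    rw [norm_smul, norm_smul, Real.norm_of_nonneg hr, Real.norm_of_nonneg hs]
  have h2 := mul_le_mul_of_nonneg_left (Finset.sum_le_sum fun a (_ : a ∈ Finset.univ) => h a) hc
  refine h2.trans_eq ?_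
  rw [Finset.sum_add_distrib, ← Finset.mul_sum, ← Finset.mul_sum, smul_eq_mul, smul_eq_mul]
  ring

theorem convexOn_ridge {V E : Type*} [NormedAddCommGroup V] [InnerProductSpace ℝ V]
    [NormedAddCommGroup E] [InnerProductSpace ℝ E] (S : V →L[ℝ] E) (y : E) {κ : ℝ} (hκ : 0 ≤ κ) :
    ConvexOn ℝ Set.univ fun f => ‖S f - y‖ ^ 2 + κ * ‖f‖ ^ 2 := by
  have h1 : ConvexOn ℝ Set.univ fun f : V => ‖S f - y‖ ^ 2 := by
    have h := (convexOn_univ_norm (E := E)).pow (fun _ _ => norm_nonneg _) 2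
    exact (h.translate_left (-y)).comp_linearMap S.toLinearMap |>.congr fun f _ => by
      simp [sub_eq_add_neg]
  have h2 : ConvexOn ℝ Set.univ fun f : V => κ * ‖f‖ ^ 2 :=
    ((convexOn_univ_norm (E := V)).pow (fun _ _ => norm_nonneg _) 2).smul hκ
  exact h1.add h2

theorem sqrt_norm_adjoint_comp_self {V E : Type*} [NormedAddCommGroup V] [InnerProductSpace ℝ V]
    [CompleteSpace V] [NormedAddCommGroup E] [InnerProductSpace ℝ E] [CompleteSpace E]
    (D : V →L[ℝ] E) : Real.sqrt ‖(ContinuousLinearMap.adjoint D).comp D‖ = ‖D‖ := by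
  rw [ContinuousLinearMap.norm_adjoint_comp_self, Real.sqrt_mul_self (norm_nonneg _)]

end Operators

/-! ### The iterates -/

section Iterates

theorem norm_ballProj_le {n : ℕ} [NeZero n] {r : ℝ} (hr : 0 ≤ r) (w : EmpVec n) :
    ‖ballProj r w‖ ≤ r := by
  rw [ballProj]
  split_ifs with h
  · exact h
  · have hw : 0 < ‖w‖ := hr.trans_lt (not_le.mp h)
    rw [norm_smul, norm_div, norm_norm, Real.norm_of_nonneg hr, div_mul_cancel₀ _ hw.ne']

theorem map_extrapolate {V W : Type*} [AddCommGroup V] [Module ℝ V] [AddCommGroup W] [Module ℝ W]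
    (A : V →ₗ[ℝ] W) (u : ℕ → V) (t : ℕ) :
    A (extrapolate u t) = extrapolate (fun t => A (u t)) t := by
  simp only [extrapolate, map_add, map_smul]

theorem extrapolate_add {V : Type*} [AddCommGroup V] [Module ℝ V] (u w : ℕ → V) (t : ℕ) :
    extrapolate (fun t => u t + w t) t = extrapolate u t + extrapolate w t := by
  simp only [extrapolate]
  module

variable {d n : ℕ} [NeZero n] {X : Set (EuclideanSpace ℝ (Fin d))}
variable {H : Type*} [NormedAddCommGroup H] [InnerProductSpace ℝ H] [CompleteSpace H]
variable [RKHS ℝ H X ℝ] {x : Fin n → X} {y : Fin n → ℝ} {τ ν σ η : ℝ} {q : ℕ → ℕ}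
variable {α : ℕ → EmpVec n} {β vbar : ℕ → GradVec d n}

/-- Every inner step ends with a projection onto the balls; when no step is made, the previous
vector is inherited, starting from `0`. -/
theorem IsAlgorithmRun.vbar_mem (h : IsAlgorithmRun H x y τ ν σ η q α β vbar) (hr : 0 ≤ τ / σ)
    {t : ℕ} (ht : 1 ≤ t) : vbar t ∈ prodBall d n (τ / σ) := by
  induction t, ht using Nat.le_induction with
  | base =>
    intro a
    rw [h.vbar_one]
    simpa using hr
  | succ t ht ih =>
    rw [h.vbar_step (t + 1) (by omega), Nat.add_sub_cancel]
    generalize q (t + 1) = k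
    cases k with
    | zero => exact ih
    | succ k =>
      rw [Function.iterate_succ_apply']
      exact fun a => norm_ballProj_le hr _

theorem extrapolate_funOfCoeff (x : Fin n → X) (α : ℕ → EmpVec n) (β : ℕ → GradVec d n) (t : ℕ) :
    extrapolate (fun t => funOfCoeff H x (α t) (β t)) t =
      ContinuousLinearMap.adjoint (sampling H x) (extrapolate α t) +
        ContinuousLinearMap.adjoint (empGrad H x) (extrapolate β t) := by
  simp only [funOfCoeff_eq]
  rw [extrapolate_add]
  exact congrArg₂ _
    (map_extrapolate (ContinuousLinearMap.adjoint (sampling H x)).toLinearMap α t).symm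
    (map_extrapolate (ContinuousLinearMap.adjoint (empGrad H x)).toLinearMap β t).symm

/-- In the space `H` the algorithm performs a gradient step followed by the subtraction of
`∇̂* v̄ᵗ`. -/
theorem IsAlgorithmRun.funOfCoeff_step (hX : closure X = closure (interior X))
    (hk : KernelC2 (X := X) H) (h : IsAlgorithmRun H x y τ ν σ η q α β vbar) (hσ : σ ≠ 0)
    {t : ℕ} (ht : 2 ≤ t) :
    funOfCoeff H x (α t) (β t) =
      extrapolate (fun t => funOfCoeff H x (α t) (β t)) t -
        (1 / (2 * σ)) • ridgeGrad (sampling H x) (EmpVec.ofFun n y) (τ * ν)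
          (extrapolate (fun t => funOfCoeff H x (α t) (β t)) t) -
        ContinuousLinearMap.adjoint (empGrad H x) (vbar t) := by
  -- The bracket `K α̃ + ∑ Zₐ β̃ₐ - y` is the residual of the extrapolated function at the sample
  -- points.
  have hα : α t = (1 - τ * ν / σ) • extrapolate α t - (1 / σ) •
      (sampling H x (extrapolate (fun t => funOfCoeff H x (α t) (β t)) t) -
        EmpVec.ofFun n y) := by
    ext i
    rw [h.alpha_step t ht i, extrapolate_funOfCoeff, map_add, adjoint_empGrad_apply, map_sum,
      matK_mulVec]
    simp only [matZ_mulVec hX hk]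
    simp only [EmpVec.sub_apply, EmpVec.smul_apply, EmpVec.add_apply, EmpVec.ofFun_apply,
      EmpVec.sum_apply]
  rw [funOfCoeff_eq, h.beta_step t ht, map_sub, map_smul]
  rw [congrArg (ContinuousLinearMap.adjoint (sampling H x)) hα, map_sub, map_smul, map_smul,
    ridgeGrad]
  have e := extrapolate_funOfCoeff (H := H) x α β t
  generalize ContinuousLinearMap.adjoint (sampling H x) (sampling H x _ - _) = p
  rw [e]
  match_scalars <;> field_simp

end Iterates

/-! ### Identification of the vanishing derivatives -/

section Support

variable {d n : ℕ} [NeZero n] {X : Set (EuclideanSpace ℝ (Fin d))}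
variable {H : Type*} [NormedAddCommGroup H] [InnerProductSpace ℝ H] [CompleteSpace H]
variable [RKHS ℝ H X ℝ] {x : Fin n → X} {r : ℝ} {v : GradVec d n}

theorem inner_empDeriv_le (hv : v ∈ prodBall d n r) (a : Fin d) (f : H) :
    inner ℝ (v a) (empDeriv H x a f) ≤ r * ‖empDeriv H x a f‖ :=
  (real_inner_le_norm _ _).trans (mul_le_mul_of_nonneg_right (hv a) (norm_nonneg _))

/-- For `v` in the product of balls of radius `r`, each component contributes a nonnegative amount to
the gap `r Ω̂(f) - ⟨∇̂* v, f⟩`. -/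
theorem gap_component_le (hv : v ∈ prodBall d n r) (a : Fin d) (f : H) :
    (r - ‖v a‖) * ‖empDeriv H x a f‖ ≤
      r * ∑ b, ‖empDeriv H x b f‖ -
        inner ℝ (ContinuousLinearMap.adjoint (empGrad H x) v) f := by
  rw [inner_adjoint_empGrad, Finset.mul_sum, ← Finset.sum_sub_distrib]
  have h := Finset.single_le_sum
    (f := fun b => r * ‖empDeriv H x b f‖ - inner ℝ (v b) (empDeriv H x b f))
    (fun b _ => sub_nonneg.mpr (inner_empDeriv_le hv b f)) (Finset.mem_univ a)
  refine le_trans ?_ h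
  have := real_inner_le_norm (v a) (empDeriv H x a f)
  simp only
  linarith

/-- Equivalently, `∇̂* v` is a subgradient of `r Ω̂` at `0`. -/
theorem inner_adjoint_empGrad_le (hv : v ∈ prodBall d n r) (f : H) :
    inner ℝ (ContinuousLinearMap.adjoint (empGrad H x) v) f ≤ r * ∑ b, ‖empDeriv H x b f‖ := by
  rw [inner_adjoint_empGrad, Finset.mul_sum]
  exact Finset.sum_le_sum fun b _ => inner_empDeriv_le hv b f

/-- The gap at `g` is controlled by the gap at `f` and the distance of `f` and `g`. -/
theorem gap_le_gap_add (hr : 0 ≤ r) (hv : v ∈ prodBall d n r) (f g : H) :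
    r * ∑ b, ‖empDeriv H x b g‖ - inner ℝ (ContinuousLinearMap.adjoint (empGrad H x) v) g ≤
      r * ∑ b, ‖empDeriv H x b f‖ - inner ℝ (ContinuousLinearMap.adjoint (empGrad H x) v) f +
        2 * (r * ∑ b, ‖empDeriv H x b‖) * ‖f - g‖ := by
  have hop : ∀ h : H, r * ∑ b, ‖empDeriv H x b h‖ ≤ r * (∑ b, ‖empDeriv H x b‖) * ‖h‖ := fun h => by
    rw [mul_assoc, Finset.sum_mul]
    exact mul_le_mul_of_nonneg_left
      (Finset.sum_le_sum fun b _ => (empDeriv H x b).le_opNorm h) hr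
  have h1 : r * ∑ b, ‖empDeriv H x b g‖ ≤
      r * ∑ b, ‖empDeriv H x b f‖ + r * ∑ b, ‖empDeriv H x b (f - g)‖ := by
    rw [← mul_add, ← Finset.sum_add_distrib]
    refine mul_le_mul_of_nonneg_left (Finset.sum_le_sum fun b _ => ?_) hr
    rw [map_sub, add_comm]
    exact norm_le_norm_sub_add _ _ |>.trans_eq (by rw [norm_sub_rev])
  -- The regularizer and the linear term each change by at most `r Ω̂(f - g)`, whence the factor 2.
  have h2 := inner_adjoint_empGrad_le (x := x) hv (f - g)
  rw [inner_sub_right] at h2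
  have h3 := hop (f - g)
  linarith

/-- If a component of a dual solution has norm less than the radius, then the corresponding partial
derivative vanishes at the sample points. -/
theorem empDeriv_eq_zero_of_dual (hX : closure X = closure (interior X))
    (hk : KernelC2 (X := X) H) {y : Fin n → ℝ} {τ ν : ℝ} {fhat : H}
    (hfhat : ∀ g : H, objective H x y τ ν fhat ≤ objective H x y τ ν g) {σ : ℝ}
    (hσ : 0 < σ) (hv : v ∈ prodBall d n (τ / σ))
    (hgrad : ContinuousLinearMap.adjoint (empGrad H x) v =
      -(1 / (2 * σ)) • gradient (fun f : H => empRisk H x y f + τ * ν * ‖f‖ ^ 2) fhat)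
    {a : Fin d} (ha : ‖v a‖ < τ / σ) : ‖empDeriv H x a fhat‖ = 0 := by
  set S := sampling H x
  set y' := EmpVec.ofFun n y
  have hG : gradient (fun f : H => empRisk H x y f + τ * ν * ‖f‖ ^ 2) fhat =
      ridgeGrad S y' (τ * ν) fhat := by
    simp only [empRisk_eq]
    exact (hasGradientAt_ridge S y' (τ * ν) fhat).gradient
  rw [hG] at hgrad
  set G := ridgeGrad S y' (τ * ν) fhat with hGdef
  set w := 2 * τ * ∑ b, ‖empDeriv H x b fhat‖ with hw
  -- Contracting by `1 - s` scales `Ω̂` by the same factor; divide the minimality inequality by `s`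
  -- and let `s → 0⁺`.
  have hfirst : inner ℝ G fhat + w ≤ 0 := by
    set p := ‖S fhat‖ ^ 2 + τ * ν * ‖fhat‖ ^ 2 with hp
    have hlim : Tendsto (fun s : ℝ => s * p) (𝓝[>] 0) (𝓝 (0 * p)) :=
      tendsto_nhdsWithin_of_tendsto_nhds (Continuous.tendsto (by fun_prop) 0)
    rw [zero_mul] at hlim
    refine ge_of_tendsto hlim ?_
    filter_upwards [Ioo_mem_nhdsGT (zero_lt_one' ℝ)] with s hs
    have h1 := hfhat ((1 - s) • fhat)
    have e2 : ∀ b, ‖empDeriv H x b ((1 - s) • fhat)‖ = (1 - s) * ‖empDeriv H x b fhat‖ :=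
      fun b => by rw [map_smul, norm_smul, Real.norm_of_nonneg (by linarith [hs.2])]
    rw [objective_eq hX hk, objective_eq hX hk,
      ridge_expansion S y' (τ * ν) fhat ((1 - s) • fhat)] at h1
    have e1 : (1 - s) • fhat - fhat = (-s) • fhat := by module
    simp only [e2, ← Finset.mul_sum] at h1
    rw [e1, real_inner_smul_right, map_smul, norm_smul, norm_smul, mul_pow, mul_pow,
      Real.norm_eq_abs, sq_abs, ← hGdef] at h1
    have : s * (inner ℝ G fhat + w) ≤ s * (s * p) := by
      rw [hp, hw]
      linarith
    exact le_of_mul_le_mul_left this hs.1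
  have hgap := gap_component_le (x := x) hv a fhat
  rw [hgrad, real_inner_smul_left] at hgap
  have hle : (τ / σ - ‖v a‖) * ‖empDeriv H x a fhat‖ ≤ 0 := by
    refine hgap.trans ?_
    have : τ / σ * ∑ b, ‖empDeriv H x b fhat‖ - -(1 / (2 * σ)) * inner ℝ G fhat =
        (1 / (2 * σ)) * (inner ℝ G fhat + w) := by
      rw [hw]
      field_simp
      ring
    rw [this]
    exact mul_nonpos_of_nonneg_of_nonpos (by positivity) hfirst
  exact le_antisymm (nonpos_of_mul_nonpos_right hle (sub_pos.mpr ha)) (norm_nonneg _)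

/-- Convergence rate of the objective along the algorithm. -/
theorem IsAlgorithmRun.exists_rate {y : Fin n → ℝ} {τ ν σ η l : ℝ} {q : ℕ → ℕ}
    {α : ℕ → EmpVec n} {β vbar : ℕ → GradVec d n} {ε : ℕ → ℝ}
    (h : IsAlgorithmRun H x y τ ν σ η q α β vbar)
    (hX : closure X = closure (interior X)) (hk : KernelC2 (X := X) H) (hτ : 0 < τ) (hν : 0 < ν)
    {fhat : H} (hfhat : ∀ g : H, objective H x y τ ν fhat ≤ objective H x y τ ν g)
    (hσ : ‖(ContinuousLinearMap.adjoint (sampling H x)).comp (sampling H x)‖ + τ * ν ≤ σ)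
    (hl : 3 / 2 < l) (hε : ε =O[atTop] fun t : ℕ => (t : ℝ) ^ (-l))
    (hgap : ∀ t, 2 ≤ t → 2 * τ / σ * empReg H x (funOfCoeff H x (α t) (β t)) -
      2 * inner ℝ (ContinuousLinearMap.adjoint (empGrad H x) (vbar t))
        (funOfCoeff H x (α t) (β t)) ≤ ε t ^ 2) :
    ∃ C : ℝ, 0 < C ∧ ∀ t : ℕ, 2 ≤ t → objective H x y τ ν (funOfCoeff H x (α t) (β t)) -
      objective H x y τ ν fhat ≤ C / (t : ℝ) ^ 2 := by
  have hτν : 0 < τ * ν := mul_pos hτ hν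
  have hσ0 : 0 < σ := by
    have := norm_nonneg ((ContinuousLinearMap.adjoint (sampling H x)).comp (sampling H x))
    linarith
  have hJ : ConvexOn ℝ Set.univ (objective H x y τ ν) :=
    ((convexOn_ridge (sampling H x) (EmpVec.ofFun n y) hτν.le).add
      (convexOn_sum_norm (fun a => empDeriv H x a) (c := 2 * τ) (by positivity))).congr
      fun f _ => (objective_eq hX hk x y τ ν f).symm
  refine exists_fista_rate hJ hσ0 hfhat (fun t => sq_nonneg (ε t))
    (summable_sq_mul_sq_of_isBigO hl hε) fun t ht g => ?_
  rw [objective_eq hX hk, objective_eq hX hk]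
  -- Here `R = 2τ Ω̂` and `p = ∇̂* v̄ᵗ`: feasibility of `v̄ᵗ` bounds `2σ⟨p, g⟩` by `R g`, and the
  -- stopping rule times `σ` bounds `R f - 2σ⟨p, f⟩` at `f = fᵗ`.
  refine inexact_prox_step (sampling H x) (EmpVec.ofFun n y) hτν.le hσ
    (R := fun f => 2 * τ * ∑ a, ‖empDeriv H x a f‖)
    (h.funOfCoeff_step hX hk hσ0.ne' ht) hσ0 (fun g => ?_) g
  have h1 := hgap t ht
  have h2 := inner_adjoint_empGrad_le (x := x)
    (h.vbar_mem (div_nonneg hτ.le hσ0.le) (by omega : 1 ≤ t)) g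
  rw [empReg_eq hX hk] at h1
  have h3 := mul_le_mul_of_nonneg_left h1 hσ0.le
  have h4 := mul_le_mul_of_nonneg_left h2 (by positivity : 0 ≤ 2 * σ)
  have e1 : ∀ s : ℝ, σ * (2 * τ / σ * s) = 2 * τ * s := fun s => by field_simp
  have e2 : ∀ s : ℝ, 2 * σ * (τ / σ * s) = 2 * τ * s := fun s => by field_simp
  rw [mul_sub, e1] at h3
  rw [e2] at h4
  rw [inner_sub_right]
  linarith

/-! ### The tolerances `ε̃ᵗ` -/

theorem epsTilde_sq {τ ν σ C : ℝ} (hr : 0 ≤ τ / σ) (ε : ℕ → ℝ) (t : ℕ) :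
    epsTilde H x τ ν σ C ε t ^ 2 = ε t ^ 2 + Real.sqrt (C / (τ * ν)) *
      (τ / σ * (∑ a, ‖empDeriv H x a‖) + 1) * (4 / (t : ℝ)) := by
  rw [epsTilde, Real.sq_sqrt (by positivity)]
  simp only [sqrt_norm_adjoint_comp_self]

/-- The summand 1 beside the operator norms ensures this even if `ε t` and all the `D̂ₐ` vanish. -/
theorem epsTilde_pos {τ ν σ C : ℝ} (hr : 0 ≤ τ / σ) (hC : 0 < C / (τ * ν)) (ε : ℕ → ℝ) {t : ℕ}
    (ht : 0 < t) : 0 < epsTilde H x τ ν σ C ε t :=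
  Real.sqrt_pos.mpr (by positivity)

theorem tendsto_epsTilde {τ ν σ C : ℝ} {ε : ℕ → ℝ} (hε : Tendsto ε atTop (𝓝 0)) :
    Tendsto (epsTilde H x τ ν σ C ε) atTop (𝓝 0) := by
  have h := (hε.pow 2).add ((tendsto_const_div_atTop_nhds_zero_nat 4).const_mul
    (Real.sqrt (C / (τ * ν)) * (τ / σ * ∑ a, Real.sqrt
      ‖(ContinuousLinearMap.adjoint (empDeriv H x a)).comp (empDeriv H x a)‖ + 1)))
  have h2 := h.sqrt
  rw [zero_pow two_ne_zero, mul_zero, add_zero, Real.sqrt_zero] at h2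
  exact h2

end Support

/-! ### Identification of the support by the exact dual vector and by the iterates -/

theorem proposition3 {d n : ℕ} [NeZero n] (X : Set (EuclideanSpace ℝ (Fin d)))
    (hX : closure X = closure (interior X))
    (H : Type*) [NormedAddCommGroup H] [InnerProductSpace ℝ H] [CompleteSpace H]
    [RKHS ℝ H X ℝ] (hk : KernelC2 (X := X) H)
    (x : Fin n → X) (y : Fin n → ℝ) (τ ν : ℝ) (hτ : 0 < τ) (hν : 0 < ν)
    (fhat : H) (hfhat : ∀ g : H, objective H x y τ ν fhat ≤ objective H x y τ ν g) :
    (∀ σ : ℝ, 0 < σ → ∀ v ∈ prodBall d n (τ / σ),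
      ContinuousLinearMap.adjoint (empGrad H x) v =
        -(1 / (2 * σ)) • gradient (fun f : H => empRisk H x y f + τ * ν * ‖f‖ ^ 2) fhat →
      ∀ a : Fin d, ‖v a‖ < τ / σ → ‖empDeriv H x a fhat‖ = 0) ∧
    (∀ (σ η l : ℝ) (ε : ℕ → ℝ) (q : ℕ → ℕ) (α : ℕ → EmpVec n) (β vbar : ℕ → GradVec d n),
      ‖(ContinuousLinearMap.adjoint (sampling H x)).comp (sampling H x)‖ + τ * ν ≤ σ →
      0 < η →
      ‖(empGrad H x).comp (ContinuousLinearMap.adjoint (empGrad H x))‖ ≤ η →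
      3 / 2 < l →
      Asymptotics.IsTheta atTop ε (fun t : ℕ => (t : ℝ) ^ (-l)) →
      IsAlgorithmRun H x y τ ν σ η q α β vbar →
      (∀ t, 2 ≤ t →
        2 * τ / σ * empReg H x (funOfCoeff H x (α t) (β t)) -
          2 * inner ℝ (ContinuousLinearMap.adjoint (empGrad H x) (vbar t))
            (funOfCoeff H x (α t) (β t)) ≤ ε t ^ 2) →
      ∃ C : ℝ, 0 < C ∧
        (∀ t, 2 ≤ t → objective H x y τ ν (funOfCoeff H x (α t) (β t)) -
          objective H x y τ ν fhat ≤ C / (t : ℝ) ^ 2) ∧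
        (∀ t, 2 ≤ t → 0 < epsTilde H x τ ν σ C ε t) ∧
        Tendsto (epsTilde H x τ ν σ C ε) atTop (𝓝 0) ∧
        ∀ m : ℝ, IsLeast {r : ℝ | 0 < r ∧ ∃ a : Fin d, r = ‖empDeriv H x a fhat‖} m →
          ∀ t, 2 ≤ t → ∀ a : Fin d,
            ‖vbar t a‖ < τ / σ - epsTilde H x τ ν σ C ε t ^ 2 / (2 * m) →
              ‖empDeriv H x a fhat‖ = 0) := by
  refine ⟨fun σ hσ v hv hgrad a ha => empDeriv_eq_zero_of_dual hX hk hfhat hσ hv hgrad ha, ?_⟩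
  intro σ η l ε q α β vbar hσ _ _ hl hε hrun hgap
  have hτν : 0 < τ * ν := mul_pos hτ hν
  have hσ0 : 0 < σ := by
    have := norm_nonneg ((ContinuousLinearMap.adjoint (sampling H x)).comp (sampling H x))
    linarith
  have hr : 0 ≤ τ / σ := (div_pos hτ hσ0).le
  obtain ⟨C, hC, hrate⟩ := hrun.exists_rate hX hk hτ hν hfhat hσ hl hε.isBigO hgap
  have hε0 : Tendsto ε atTop (𝓝 0) := hε.isBigO.trans_tendsto
    ((tendsto_rpow_neg_atTop (by linarith : 0 < l)).comp tendsto_natCast_atTop_atTop)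
  refine ⟨C, hC, hrate, fun t ht => epsTilde_pos hr (div_pos hC hτν) ε (by omega),
    tendsto_epsTilde hε0, fun m hm t ht a ha => ?_⟩
  by_contra hne
  have hpos : 0 < ‖empDeriv H x a fhat‖ := (norm_nonneg _).lt_of_ne' hne
  have hma : m ≤ ‖empDeriv H x a fhat‖ := hm.2 ⟨hpos, a, rfl⟩
  have hm0 : 0 < m := hm.1.1
  have ht0 : (0 : ℝ) < t := by exact_mod_cast (by omega : 0 < t)
  set f := funOfCoeff H x (α t) (β t) with hf
  -- Quadratic growth with modulus `τν` converts the rate of the values into a rate of the distance.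
  have hdist : ‖f - fhat‖ ≤ Real.sqrt (C / (τ * ν)) / t := by
    have h1 := ridge_strong_growth (sampling H x) (EmpVec.ofFun n y) (κ := τ * ν)
      (convexOn_sum_norm (fun a => empDeriv H x a) (c := 2 * τ) (by positivity))
      (fun g => by simpa only [objective_eq hX hk] using hfhat g) f
    rw [← objective_eq hX hk, ← objective_eq hX hk] at h1
    have h2 := h1.trans (hrate t ht)
    refine le_of_sq_le_sq ?_ (by positivity)
    rw [div_pow, Real.sq_sqrt (by positivity), div_div, mul_comm (τ * ν), ← div_div,
      le_div_iff₀ hτν]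
    linarith
  have hv := hrun.vbar_mem hr (by omega : 1 ≤ t)
  have h1 := gap_component_le (x := x) hv a fhat
  have h2 := gap_le_gap_add (x := x) hr hv f fhat
  have h3 := hgap t ht
  rw [empReg_eq hX hk, ← hf] at h3
  have h4 : (2 * (τ / σ * ∑ b, ‖empDeriv H x b‖)) * ‖f - fhat‖ ≤
      (2 * (τ / σ * ∑ b, ‖empDeriv H x b‖)) * (Real.sqrt (C / (τ * ν)) / t) :=
    mul_le_mul_of_nonneg_left hdist (by positivity)
  have h5 := epsTilde_sq (H := H) (x := x) (ν := ν) (C := C) hr ε t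
  -- With `m ≤ ‖D̂ₐ f̂‖` the gap at the minimizer would exceed `(ε̃ᵗ)²/2`, whereas `h2`, `h3` and
  -- `h4` bound it by that quantity.
  have h6 : epsTilde H x τ ν σ C ε t ^ 2 / 2 < (τ / σ - ‖vbar t a‖) * m := by
    have : epsTilde H x τ ν σ C ε t ^ 2 / (2 * m) < τ / σ - ‖vbar t a‖ := by linarith
    rw [div_lt_iff₀ (by positivity)] at this
    linarith
  have h7 : (τ / σ - ‖vbar t a‖) * m ≤ (τ / σ - ‖vbar t a‖) * ‖empDeriv H x a fhat‖ := by
    refine mul_le_mul_of_nonneg_left hma ?_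
    have : 0 ≤ epsTilde H x τ ν σ C ε t ^ 2 / (2 * m) := by positivity
    linarith
  -- This is the part of `(ε̃ᵗ)²/2` due to the summand 1; the upper bound on the gap can spare it.
  have h8 : 0 ≤ Real.sqrt (C / (τ * ν)) * (2 / t) := by positivity
  have e1 : Real.sqrt (C / (τ * ν)) * (τ / σ * (∑ a, ‖empDeriv H x a‖) + 1) * (4 / (t : ℝ)) =
      2 * ((2 * (τ / σ * ∑ b, ‖empDeriv H x b‖)) * (Real.sqrt (C / (τ * ν)) / t) +
        Real.sqrt (C / (τ * ν)) * (2 / t)) := by ring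
  have e2 : 2 * τ / σ * ∑ b, ‖empDeriv H x b f‖ = 2 * (τ / σ * ∑ b, ‖empDeriv H x b f‖) := by ring
  rw [e1] at h5
  rw [e2] at h3
  linarith
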